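/- An ordered graph is a finite simple graph together with a linear ordering $\prec$ of its vertex set; we write $u\preceq v$ if $u\prec v$ or $u=v$. An ordered graph $G$ contains a copy of an ordered graph $H$ if $H$ is isomorphic, by an order-preserving graph isomorphism, to a (not necessarily induced) subgraph of $G$ with the inherited vertex ordering. Let $\mathrm{Forb}_\prec(H)$ be the set of all ordered graphs that do not contain a copy of $H$, and let $f_\prec(H)=\sup\{\chi(G)\mid G\in\mathrm{Forb}_\prec(H)\}\in\mathbb{N}\cup\{\infty\}$. A bonnet is an ordered graph with $4$ or $5$ vertices such that either its vertices are $u_1\prec u_2\preceq u_3\prec u_4\preceq u_5$ and its edges are $u_1u_2,\ u_1u_5,\ u_3u_4$, or its vertices are $u_1\preceq u_2\prec u_3\preceq u_4\prec u_5$ and its edges are $u_1u_5,\ u_4u_5,\ u_2u_3$. Two edges cross if they can be named $uv$ and $u'v'$ with $u\prec u'\prec v\prec v'$. An ordered graph that is a path $u_1,\dots,u_n$ (vertices listed along the path) is a tangled path if there is an index $i$ with $1<i<n$ such that $u_i$ is leftmost or rightmost (with respect to $\prec$) among all the vertices of the path and some edge of the subpath $u_1,\dots,u_i$ crosses some edge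 of the subpath $u_i,\dots,u_n$. **Theorem.** If an ordered graph $H$ contains a cycle, a bonnet, or a tangled path, then $f_\prec(H)=\infty$. In other words, for every $k\in\mathbb{N}$ the set $\mathrm{Forb}_\prec(H)$ contains an ordered graph of chromatic number at least $k$. -/

import Mathlib

universe u

/-- A (finite, simple) ordered graph: a finite graph together with a linear ordering of its
vertex set. -/
structure OrderedGraph : Type (u + 1) where
  /-- The vertex set. -/
  V : Type u
  /-- The linear ordering of the vertices. -/
  [order : LinearOrder V]
  [finite : Finite V]
  /-- The underlying unordered graph. -/
  graph : SimpleGraph V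

namespace OrderedGraph

attribute [instance] OrderedGraph.order OrderedGraph.finite

/-- `G.Contains H`: some (not necessarily induced) ordered subgraph of `G` is a copy of `H`.
Such copies are exactly the images of the strictly increasing (hence injective) graph
homomorphisms from `H` to `G`. -/
def Contains (G H : OrderedGraph.{u}) : Prop :=
  ∃ φ : H.graph →g G.graph, StrictMono φ

/-- The set of all ordered graphs that do not contain a copy of `H`. -/
def Forb (H : OrderedGraph.{u}) : Set OrderedGraph.{u} :=
  {G | ¬ G.Contains H}

/-- The supremum, in `ℕ ∪ {∞}`, of the chromatic numbers of the ordered graphs that do not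
contain a copy of `H`. -/
noncomputable def f (H : OrderedGraph.{u}) : ℕ∞ :=
  ⨆ G ∈ Forb H, G.graph.chromaticNumber

/-- `H` contains a cycle (as an unordered graph). -/
def ContainsCycle (H : OrderedGraph.{u}) : Prop :=
  ∃ (v : H.V) (c : H.graph.Walk v v), c.IsCycle

/-- A bonnet: an ordered graph with four or five vertices, which are either
`u₁ ≺ u₂ ⪯ u₃ ≺ u₄ ⪯ u₅`, with the edges `u₁u₂, u₁u₅, u₃u₄`, or
`u₁ ⪯ u₂ ≺ u₃ ⪯ u₄ ≺ u₅`, with the edges `u₁u₅, u₄u₅, u₂u₃`. -/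
def IsBonnet (B : OrderedGraph.{u}) : Prop :=
  (Nat.card B.V = 4 ∨ Nat.card B.V = 5) ∧
  ∃ u₁ u₂ u₃ u₄ u₅ : B.V,
    (∀ x : B.V, x = u₁ ∨ x = u₂ ∨ x = u₃ ∨ x = u₄ ∨ x = u₅) ∧
    ((u₁ < u₂ ∧ u₂ ≤ u₃ ∧ u₃ < u₄ ∧ u₄ ≤ u₅ ∧
        B.graph.edgeSet = {s(u₁, u₂), s(u₁, u₅), s(u₃, u₄)}) ∨
      (u₁ ≤ u₂ ∧ u₂ < u₃ ∧ u₃ ≤ u₄ ∧ u₄ < u₅ ∧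
        B.graph.edgeSet = {s(u₁, u₅), s(u₄, u₅), s(u₂, u₃)}))

/-- Two edges cross if, for a suitable naming of the edges and of their ends, they are `ab` and
`cd` with `a ≺ c ≺ b ≺ d`. -/
def EdgesCross {V : Type u} [LinearOrder V] (e e' : Sym2 V) : Prop :=
  ∃ a b c d : V, a < c ∧ c < b ∧ b < d ∧
    ((e = s(a, b) ∧ e' = s(c, d)) ∨ (e' = s(a, b) ∧ e = s(c, d)))

/-- A tangled path: an ordered path `P` (with its vertices numbered along the path, starting with
`0`, by the isomorphism `p`) that has an inner vertex `p i` which is leftmost or rightmost in `P`,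
such that an edge of the subpath from the first vertex to `p i` crosses an edge of the subpath
from `p i` to the last vertex. -/
def IsTangledPath (P : OrderedGraph.{u}) : Prop :=
  ∃ (n : ℕ) (p : SimpleGraph.pathGraph n ≃g P.graph) (i : Fin n),
    0 < (i : ℕ) ∧ (i : ℕ) + 1 < n ∧
    ((∀ x : P.V, p i ≤ x) ∨ (∀ x : P.V, x ≤ p i)) ∧
    ∃ j j' k k' : Fin n,
      (j : ℕ) + 1 = j' ∧ j' ≤ i ∧ i ≤ k ∧ (k : ℕ) + 1 = k' ∧
      EdgesCross s(p j, p j') s(p k, p k')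

/-- `H` contains a copy of a bonnet. -/
def ContainsBonnet (H : OrderedGraph.{u}) : Prop :=
  ∃ B : OrderedGraph.{u}, B.IsBonnet ∧ H.Contains B

/-- `H` contains a copy of a tangled path. -/
def ContainsTangledPath (H : OrderedGraph.{u}) : Prop :=
  ∃ P : OrderedGraph.{u}, P.IsTangledPath ∧ H.Contains P

end OrderedGraph

/-!
Each of the three cases needs, for every `k`, an ordered graph that is not `k`-colorable and avoids
one kind of pattern; the chromatic number is then unbounded on `OrderedGraph.Forb H`.

*Bonnets.* The shift graph on the pairs `(i, j)` with `i < j`, where `(i, j)` is joined to `(j, k)`,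
has large chromatic number (`le_of_colorable_shiftGraph`). In its lexicographic order all right
neighbours of a vertex, and all vertices between two of them, have the same first entry and are
pairwise nonadjacent, which excludes the first kind of bonnet (`not_adj_shiftGraph`). The order dual
excludes the second kind.

*Cycles and tangled paths.* For all `ℓ` and `k` there is an ordered graph that is not `k`-colorable,
has no cycle of at most `ℓ` vertices, and in which the leftmost vertex of a path of at most `ℓ`
vertices always separates the path: one of the two branches leaving that vertex lies entirely to the
left of the other (`exists_hasSeparatedBranches`). Such branches do not cross, so there is no short
tangled path with a leftmost inner vertex; the order dual takes care of rightmost ones.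

The graphs are built by induction on `k`. Given a graph `Y` for `k`, take a large grid
`Fin (d + 1) → Fin b`, put a copy of `Y` at every grid point `J`, add a vertex for every
axis-parallel line of the grid, and join the vertex `y` of the copy at `J` to the line through `J` in
a direction `h J y`, where the `h J y` are chosen at random. The points at which `h J` is not
injective, or from which a short closed-up chain of grid points starts (`IsGoodPoint`), are left
unjoined.

* There are few such points compared with the number of lines (`card_not_isGoodPoint_le`). For each
  fixed colouring of the lines, a point sees a single colour on its lines with probability bounded
  below, and independently of the other points. The number of points exceeds the number of lines by
  a factor `C` that may be chosen large, so a union bound over all colourings of the lines shows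
  that some choice of directions has, for every colouring, a good point whose lines all have the
  same colour (`exists_directions`). The copy of `Y` at that point cannot use this colour.
* The goodness condition makes the directions of the lines on a short path distinct
  (`nodup_filterMap_dir`). Since an edge changes no coordinate except in the direction of its line,
  a short cycle cannot pass through a line (`not_chain_grid`). The vertices are ordered
  lexicographically by their coordinates, a line having the coordinate `⊥` in its own direction.
  Hence the line of least direction on a short path is its leftmost vertex, and the two branches
  leave it with different values of that coordinate, which then stay constant (`separated_grid`).
-/

namespace OrderedGraph

open Finset

/-! ### Counting functions -/

/-- Independent constraints on distinct coordinates of a uniformly random function multiply: if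
each constraint `h i ∈ F i`, `i ∈ S`, holds with probability at most `B / A`, then all of them hold
with probability at most `(B / A) ^ #S`. -/
theorem card_forall_mem_mul_pow_le {ι α : Type*} [Fintype ι] [DecidableEq ι] [Fintype α]
    [DecidableEq α] (S : Finset ι) (F : ι → Finset α) (A B : ℕ)
    (hF : ∀ i ∈ S, #(F i) * A ≤ Fintype.card α * B) :
    #{h : ι → α | ∀ i ∈ S, h i ∈ F i} * A ^ #S ≤ Fintype.card (ι → α) * B ^ #S := by
  have h1 : ({h : ι → α | ∀ i ∈ S, h i ∈ F i} : Finset (ι → α)) =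
      Fintype.piFinset fun i => if i ∈ S then F i else univ := by
    ext h
    simp only [mem_filter, mem_univ, true_and, Fintype.mem_piFinset]
    refine forall_congr' fun i => ?_
    split_ifs with hi <;> simp [hi]
  have h2 : ∀ X : ℕ, X ^ #S = ∏ i : ι, if i ∈ S then X else 1 := by
    intro X
    rw [prod_ite_mem, univ_inter, prod_const]
  rw [h1, Fintype.card_piFinset, h2 A, h2 B, Fintype.card_fun, ← card_univ (α := ι),
    ← prod_const, ← prod_mul_distrib, ← prod_mul_distrib]
  refine prod_le_prod' fun i _ => ?_
  split_ifs with hi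
  · exact hF i hi
  · simp

theorem card_two_mem_range_mul_le {Y D : Type*} [Fintype Y] [DecidableEq Y] [Nonempty Y]
    [Fintype D] [DecidableEq D] {p q : D} (hpq : p ≠ q) :
    #{f : Y → D | p ∈ Set.range f ∧ q ∈ Set.range f} * Fintype.card D ^ 2 ≤
      Fintype.card (Y → D) * Fintype.card Y ^ 2 := by
  classical
  have key : ∀ f : Y → D, ∃ y z : Y, p ∈ Set.range f ∧ q ∈ Set.range f → f y = p ∧ f z = q := by
    intro f
    by_cases hf : p ∈ Set.range f ∧ q ∈ Set.range f
    · obtain ⟨⟨y, hy⟩, z, hz⟩ := hf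
      exact ⟨y, z, fun _ => ⟨hy, hz⟩⟩
    · exact ⟨Classical.arbitrary Y, Classical.arbitrary Y, fun h => absurd h hf⟩
  choose y z hyz using key
  have hcard : Fintype.card (Y → D) * Fintype.card Y ^ 2 =
      #(univ : Finset ((Y → D) × Y × Y)) := by
    rw [card_univ, Fintype.card_prod, Fintype.card_prod, sq]
  have hcard' : #{f : Y → D | p ∈ Set.range f ∧ q ∈ Set.range f} * Fintype.card D ^ 2 =
      #(({f : Y → D | p ∈ Set.range f ∧ q ∈ Set.range f} : Finset (Y → D)) ×ˢ (univ : Finset (D × D))) := by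
    rw [card_product, card_univ, Fintype.card_prod, sq]
  rw [hcard, hcard']
  -- Overwriting `p` and `q` by arbitrary values loses no information if the places are recorded.
  refine card_le_card_of_injOn
    (fun x => (Function.update (Function.update x.1 (y x.1) x.2.1) (z x.1) x.2.2, y x.1, z x.1))
    (fun _ _ => by simp) ?_
  rintro ⟨f, a, b⟩ hf ⟨f', a', b'⟩ hf' heq
  simp only [coe_product, coe_filter, mem_univ, true_and, coe_univ, Set.mem_prod,
    Set.mem_ofPred_eq, Set.mem_univ, and_true] at hf hf'
  simp only [Prod.mk.injEq] at heq
  obtain ⟨h1, h2, h3⟩ := heq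
  obtain ⟨hy, hz⟩ := hyz f hf
  obtain ⟨hy', hz'⟩ := hyz f' hf'
  rw [← h2, ← h3] at h1
  rw [← h2] at hy'
  rw [← h3] at hz'
  have hne : y f ≠ z f := fun h => hpq (by rw [← hy, ← hz, h])
  have hb : b = b' := by simpa using congrFun h1 (z f)
  have ha : a = a' := by simpa [Function.update_of_ne hne] using congrFun h1 (y f)
  have hff : f = f' := by
    funext w
    by_cases hw : w = y f
    · rw [hw, hy, hy']
    by_cases hw' : w = z f
    · rw [hw', hz, hz']
    simpa [Function.update_of_ne hw, Function.update_of_ne hw'] using congrFun h1 w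
  rw [hff, ha, hb]

theorem card_not_injective_mul_le {Y D : Type*} [Fintype Y] [DecidableEq Y] [Nonempty Y]
    [Fintype D] [DecidableEq D] :
    #{f : Y → D | ¬ f.Injective} * Fintype.card D ≤
      Fintype.card (Y → D) * Fintype.card Y ^ 2 := by
  classical
  have key : ∀ f : Y → D, ∃ y z : Y, ¬ f.Injective → f y = f z ∧ y ≠ z := by
    intro f
    by_cases hf : f.Injective
    · exact ⟨Classical.arbitrary Y, Classical.arbitrary Y, fun h => absurd hf h⟩
    · obtain ⟨y, z, h⟩ := Function.not_injective_iff.1 hf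
      exact ⟨y, z, fun _ => h⟩
  choose y z hyz using key
  have hcard : Fintype.card (Y → D) * Fintype.card Y ^ 2 =
      #(univ : Finset ((Y → D) × Y × Y)) := by
    rw [card_univ, Fintype.card_prod, Fintype.card_prod, sq]
  have hcard' : #{f : Y → D | ¬ f.Injective} * Fintype.card D =
      #(({f : Y → D | ¬ f.Injective} : Finset (Y → D)) ×ˢ (univ : Finset D)) := by
    rw [card_product, card_univ]
  rw [hcard, hcard']
  refine card_le_card_of_injOn (fun x => (Function.update x.1 (y x.1) x.2, y x.1, z x.1))
    (fun _ _ => by simp) ?_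
  rintro ⟨f, a⟩ hf ⟨f', a'⟩ hf' heq
  simp only [coe_product, coe_filter, mem_univ, true_and, coe_univ, Set.mem_prod,
    Set.mem_ofPred_eq, Set.mem_univ, and_true] at hf hf'
  simp only [Prod.mk.injEq] at heq
  obtain ⟨h1, h2, h3⟩ := heq
  obtain ⟨hy, hne⟩ := hyz f hf
  obtain ⟨hy', -⟩ := hyz f' hf'
  rw [← h2] at h1
  rw [← h2, ← h3] at hy'
  have ha : a = a' := by simpa using congrFun h1 (y f)
  have hff : f = f' := by
    have hw : ∀ w, w ≠ y f → f w = f' w := fun w hw => by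
      simpa [Function.update_of_ne hw] using congrFun h1 w
    funext w
    by_cases h : w = y f
    · rw [h, hy, hy', hw _ hne.symm]
    · exact hw w h
  rw [hff, ha]

/-- If `D` is coloured with `k` colours, then a random `f : Y → D` is monochromatic with
probability at least `k ^ (-#Y)`. -/
theorem card_pow_le_card_monochromatic_mul {Y D : Type*} [Fintype Y] [DecidableEq Y] [Fintype D]
    [DecidableEq D] {k : ℕ} (ψ : D → Fin k) (hD : 0 < Fintype.card D) :
    Fintype.card (Y → D) ≤ #{f : Y → D | ∃ c, ∀ y, ψ (f y) = c} * k ^ Fintype.card Y := by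
  classical
  obtain ⟨c, hc⟩ : ∃ c : Fin k, Fintype.card D ≤ #{t | ψ t = c} * k := by
    by_contra! hcon
    have h1 : Fintype.card D = ∑ c : Fin k, #{t | ψ t = c} := by
      rw [← card_univ]
      exact card_eq_sum_card_fiberwise fun _ _ => by simp
    have hk : 0 < k := by
      obtain ⟨t⟩ := Fintype.card_pos_iff.1 hD
      exact (ψ t).pos
    have h2 : ∑ c : Fin k, #{t | ψ t = c} * k < ∑ _c : Fin k, Fintype.card D :=
      sum_lt_sum_of_nonempty ⟨⟨0, hk⟩, mem_univ _⟩ fun c _ => hcon c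
    rw [← sum_mul, ← h1, sum_const, card_univ, Fintype.card_fin, smul_eq_mul, mul_comm] at h2
    exact lt_irrefl _ h2
  have h3 : #(Fintype.piFinset fun _ : Y => ({t | ψ t = c} : Finset D)) ≤
      #{f : Y → D | ∃ c, ∀ y, ψ (f y) = c} := by
    refine card_le_card fun f hf => ?_
    simp only [Fintype.mem_piFinset, mem_filter, mem_univ, true_and] at hf ⊢
    exact ⟨c, hf⟩
  rw [Fintype.card_piFinset, prod_const, card_univ] at h3
  calc Fintype.card (Y → D) = Fintype.card D ^ Fintype.card Y := Fintype.card_fun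
    _ ≤ (#{t | ψ t = c} * k) ^ Fintype.card Y := Nat.pow_le_pow_left hc _
    _ = #{t | ψ t = c} ^ Fintype.card Y * k ^ Fintype.card Y := mul_pow _ _ _
    _ ≤ _ := Nat.mul_le_mul_right _ h3

/-- A Chernoff-type bound for the lower tail: if `g i ∈ F i` has probability at least `q` for each
`i`, independently, then at most `L` of these events happen with probability at most
`2 ^ L * (1 - q / 2) ^ n`. -/
theorem card_few_mem_le {ι α : Type*} [Fintype ι] [DecidableEq ι] [Fintype α]
    [DecidableEq α] (F : ι → Finset α) {q : ℝ}
    (hF : ∀ i, q * Fintype.card α ≤ #(F i)) (L : ℕ) :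
    (#{h : ι → α | #{i | h i ∈ F i} ≤ L} : ℝ) ≤
      2 ^ L * (Fintype.card (ι → α) * (1 - q / 2) ^ Fintype.card ι) := by
  classical
  -- The expectation of `2 ^ (-number of events)` is a product.
  have hprod : ∑ h : ι → α, ∏ i, (if h i ∈ F i then (1 / 2 : ℝ) else 1) =
      ∏ i, ∑ a : α, (if a ∈ F i then (1 / 2 : ℝ) else 1) := by
    rw [prod_univ_sum, Fintype.piFinset_univ]
  have hterm : ∀ h : ι → α, ∏ i, (if h i ∈ F i then (1 / 2 : ℝ) else 1) =
      (1 / 2) ^ #{i | h i ∈ F i} := by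
    intro h
    rw [prod_ite]
    simp
  have hfac : ∀ i, ∑ a : α, (if a ∈ F i then (1 / 2 : ℝ) else 1) ≤
      Fintype.card α * (1 - q / 2) := by
    intro i
    have : ∑ a : α, (if a ∈ F i then (1 / 2 : ℝ) else 1) =
        ∑ a : α, (1 - (if a ∈ F i then (1 / 2 : ℝ) else 0)) := by
      refine sum_congr rfl fun a _ => ?_
      split_ifs <;> norm_num
    rw [this, sum_sub_distrib, sum_ite_mem, univ_inter]
    simp only [sum_const, card_univ, nsmul_eq_mul, mul_one]
    linarith [hF i]
  have hlow : (#{h : ι → α | #{i | h i ∈ F i} ≤ L} : ℝ) * (1 / 2) ^ L ≤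
      ∑ h : ι → α, ∏ i, (if h i ∈ F i then (1 / 2 : ℝ) else 1) := by
    calc (#{h : ι → α | #{i | h i ∈ F i} ≤ L} : ℝ) * (1 / 2) ^ L
        = ∑ h : ι → α with #{i | h i ∈ F i} ≤ L, (1 / 2 : ℝ) ^ L := by
          rw [sum_const, nsmul_eq_mul]
      _ ≤ ∑ h : ι → α with #{i | h i ∈ F i} ≤ L, (1 / 2 : ℝ) ^ #{i | h i ∈ F i} :=
          sum_le_sum fun h hh => pow_le_pow_of_le_one (by norm_num) (by norm_num)
            (mem_filter.1 hh).2
      _ ≤ ∑ h : ι → α, (1 / 2 : ℝ) ^ #{i | h i ∈ F i} :=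
          sum_le_sum_of_subset_of_nonneg (filter_subset _ _) fun _ _ _ => by positivity
      _ = _ := sum_congr rfl fun h _ => (hterm h).symm
  have hup : ∏ i, ∑ a : α, (if a ∈ F i then (1 / 2 : ℝ) else 1) ≤
      Fintype.card (ι → α) * (1 - q / 2) ^ Fintype.card ι := by
    calc ∏ i, ∑ a : α, (if a ∈ F i then (1 / 2 : ℝ) else 1)
        ≤ ∏ _i : ι, (Fintype.card α * (1 - q / 2)) :=
          prod_le_prod (fun i _ => sum_nonneg fun a _ => by split_ifs <;> norm_num)
            fun i _ => hfac i
      _ = _ := by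
          rw [prod_const, card_univ, mul_pow, Fintype.card_fun, Nat.cast_pow]
  have h2 : (0 : ℝ) < 2 ^ L := by positivity
  have := hlow.trans (hprod.le.trans hup)
  rw [one_div, inv_pow, ← div_eq_mul_inv, div_le_iff₀ h2] at this
  linarith

/-! ### Grid chains -/

/-- The constraints met by a chain of grid points. The chain starts at `J` and is described by a
list `l` of steps `(s, v)`, each of which replaces the `s`-th coordinate by `v`. An entry
`(J', p', q')` says that the chain enters `J'` in direction `p'` and leaves it in direction `q'`;
it enters its first point in direction `p` and leaves its last point in direction `t`. -/
def chainTriples {d b : ℕ} (t : Fin (d + 1)) : (Fin (d + 1) → Fin b) → Fin (d + 1) →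
    List (Fin (d + 1) × Fin b) → List ((Fin (d + 1) → Fin b) × Fin (d + 1) × Fin (d + 1))
  | J, p, [] => [(J, p, t)]
  | J, p, (s, v) :: l => (J, p, s) :: chainTriples t (Function.update J s v) s l

/-- Every step of the chain that starts at `J` really moves to another point. -/
def ProperSteps {d b : ℕ} : (Fin (d + 1) → Fin b) → List (Fin (d + 1) × Fin b) → Prop
  | _, [] => True
  | J, (s, v) :: l => J s ≠ v ∧ ProperSteps (Function.update J s v) l

/-- Given directions `h J y` attached to the grid points `J`, a point `J` is good if its directions
are distinct and it is not the first point of a chain of at most `G` steps in distinct directions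
which moves only along attached directions (attached at both ends of the step), and whose first and
last points share a further direction `t`. -/
def IsGoodPoint {d b : ℕ} {Y : Type*} (h : (Fin (d + 1) → Fin b) → Y → Fin (d + 1)) (G : ℕ)
    (J : Fin (d + 1) → Fin b) : Prop :=
  (h J).Injective ∧ ∀ (t : Fin (d + 1)) (l : List (Fin (d + 1) × Fin b)), l ≠ [] →
    l.length ≤ G → (t :: l.map Prod.fst).Nodup → ProperSteps J l →
    ¬ ∀ x ∈ chainTriples t J t l, x.2.1 ∈ Set.range (h x.1) ∧ x.2.2 ∈ Set.range (h x.1)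

section Chains

variable {d b : ℕ} {t : Fin (d + 1)}

theorem length_chainTriples (l : List (Fin (d + 1) × Fin b)) (J : Fin (d + 1) → Fin b)
    (p : Fin (d + 1)) : (chainTriples t J p l).length = l.length + 1 := by
  induction l generalizing J p with
  | nil => rfl
  | cons a l ih => simp [chainTriples, ih]

theorem apply_eq_of_mem_chainTriples {l : List (Fin (d + 1) × Fin b)} {J : Fin (d + 1) → Fin b}
    {p s : Fin (d + 1)} (hs : s ∉ l.map Prod.fst) {x} (hx : x ∈ chainTriples t J p l) :
    x.1 s = J s := by
  induction l generalizing J p with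
  | nil => simp_all [chainTriples]
  | cons a l ih =>
    obtain ⟨s', v⟩ := a
    simp only [List.map_cons, List.mem_cons, not_or] at hs
    rcases List.mem_cons.1 hx with rfl | hx
    · rfl
    · rw [ih hs.2 hx, Function.update_of_ne hs.1]

/-- A chain whose steps have distinct directions never returns to a point. -/
theorem nodup_map_fst_chainTriples {l : List (Fin (d + 1) × Fin b)} {J : Fin (d + 1) → Fin b}
    {p : Fin (d + 1)} (hl : (l.map Prod.fst).Nodup) (hJ : ProperSteps J l) :
    ((chainTriples t J p l).map Prod.fst).Nodup := by
  induction l generalizing J p with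
  | nil => simp [chainTriples]
  | cons a l ih =>
    obtain ⟨s, v⟩ := a
    simp only [List.map_cons, List.nodup_cons] at hl
    simp only [chainTriples, List.map_cons, List.nodup_cons]
    refine ⟨fun hmem => ?_, ih hl.2 hJ.2⟩
    obtain ⟨x, hx, hxJ⟩ := List.mem_map.1 hmem
    have := apply_eq_of_mem_chainTriples hl.1 hx
    rw [hxJ, Function.update_self] at this
    exact hJ.1 this

theorem ne_of_mem_chainTriples {l : List (Fin (d + 1) × Fin b)} {J : Fin (d + 1) → Fin b}
    {p : Fin (d + 1)} (hl : (p :: l.map Prod.fst).Nodup) (ht : t ∉ l.map Prod.fst)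
    (hp : l = [] → p ≠ t) {x} (hx : x ∈ chainTriples t J p l) : x.2.1 ≠ x.2.2 := by
  induction l generalizing J p with
  | nil => simp_all [chainTriples]
  | cons a l ih =>
    obtain ⟨s, v⟩ := a
    rcases List.mem_cons.1 hx with rfl | hx
    · simp only [List.map_cons, List.nodup_cons, List.mem_cons, not_or] at hl
      exact hl.1.1
    · simp only [List.map_cons, List.mem_cons, not_or] at ht
      exact ih (List.nodup_cons.1 hl).2 ht.2 (fun _ => Ne.symm ht.1) hx

variable {Y : Type*} [Fintype Y] [DecidableEq Y] [Nonempty Y]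

/-- A given chain with `g` steps is realised by random directions with probability at most
`(#Y / (d + 1)) ^ (2 * (g + 1))`. -/
theorem card_chain_mul_le {l : List (Fin (d + 1) × Fin b)} {J : Fin (d + 1) → Fin b}
    (hl : l ≠ []) (hnd : (t :: l.map Prod.fst).Nodup) (hJ : ProperSteps J l) :
    #{h : (Fin (d + 1) → Fin b) → Y → Fin (d + 1) | ∀ x ∈ chainTriples t J t l,
      x.2.1 ∈ Set.range (h x.1) ∧ x.2.2 ∈ Set.range (h x.1)} * ((d + 1) ^ 2) ^ (l.length + 1) ≤
    Fintype.card ((Fin (d + 1) → Fin b) → Y → Fin (d + 1)) *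
      (Fintype.card Y ^ 2) ^ (l.length + 1) := by
  classical
  set L := chainTriples t J t l with hL
  have hndL : (L.map Prod.fst).Nodup := nodup_map_fst_chainTriples (List.nodup_cons.1 hnd).2 hJ
  have hne : ∀ x ∈ L, x.2.1 ≠ x.2.2 := fun x hx =>
    ne_of_mem_chainTriples hnd (List.nodup_cons.1 hnd).1 (fun h => absurd h hl) hx
  set S : Finset (Fin (d + 1) → Fin b) := (L.map Prod.fst).toFinset with hS
  have hcard : #S = l.length + 1 := by
    rw [hS, List.toFinset_card_of_nodup hndL, List.length_map, hL, length_chainTriples]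
  let F : (Fin (d + 1) → Fin b) → Finset (Y → Fin (d + 1)) := fun I =>
    {f | ∀ x ∈ L, x.1 = I → x.2.1 ∈ Set.range f ∧ x.2.2 ∈ Set.range f}
  have hF : ∀ I ∈ S, #(F I) * (d + 1) ^ 2 ≤
      Fintype.card (Y → Fin (d + 1)) * Fintype.card Y ^ 2 := by
    intro I hI
    obtain ⟨x, hx, hxI⟩ := List.mem_map.1 (List.mem_toFinset.1 hI)
    have h1 := card_two_mem_range_mul_le (Y := Y) (hne x hx)
    rw [Fintype.card_fin] at h1
    refine le_trans (Nat.mul_le_mul_right _ (card_le_card fun f hf => ?_)) h1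
    simp only [F, mem_filter, mem_univ, true_and] at hf ⊢
    exact hf x hx hxI
  have h2 := card_forall_mem_mul_pow_le S F _ _ hF
  rw [hcard] at h2
  refine le_trans (Nat.mul_le_mul_right _ (card_le_card fun h hh => ?_)) h2
  simp only [F, mem_filter, mem_univ, true_and] at hh ⊢
  rintro I - x hx rfl
  exact hh x hx

theorem card_not_injective_apply_mul_le (J : Fin (d + 1) → Fin b) :
    #{h : (Fin (d + 1) → Fin b) → Y → Fin (d + 1) | ¬ (h J).Injective} * (d + 1) ≤
      Fintype.card ((Fin (d + 1) → Fin b) → Y → Fin (d + 1)) * Fintype.card Y ^ 2 := by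
  classical
  have h := card_forall_mem_mul_pow_le {J} (fun _ => ({f : Y → Fin (d + 1) | ¬ f.Injective}))
    (d + 1) (Fintype.card Y ^ 2) (fun _ _ => by
      simpa using card_not_injective_mul_le (Y := Y) (D := Fin (d + 1)))
  simpa using h

open scoped Classical in
/-- The number of random directions for which a given point is not good. -/
theorem card_not_isGoodPoint_le (C G : ℕ) (hb : b = C * (d + 1)) (J : Fin (d + 1) → Fin b) :
    (#{h : (Fin (d + 1) → Fin b) → Y → Fin (d + 1) | ¬ IsGoodPoint h G J} : ℝ) ≤
      Fintype.card ((Fin (d + 1) → Fin b) → Y → Fin (d + 1)) / (d + 1) *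
        ∑ g ∈ range (G + 1), (C : ℝ) ^ g * (Fintype.card Y ^ 2) ^ (g + 1) := by
  classical
  set n := Fintype.card Y
  set O := Fintype.card ((Fin (d + 1) → Fin b) → Y → Fin (d + 1))
  let E : (g : ℕ) → Fin (d + 1) → (Fin g → Fin (d + 1) × Fin b) →
      Finset ((Fin (d + 1) → Fin b) → Y → Fin (d + 1)) := fun g t f =>
    {h | List.ofFn f ≠ [] ∧ (t :: (List.ofFn f).map Prod.fst).Nodup ∧ ProperSteps J (List.ofFn f) ∧
      ∀ x ∈ chainTriples t J t (List.ofFn f),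
        x.2.1 ∈ Set.range (h x.1) ∧ x.2.2 ∈ Set.range (h x.1)}
  have hT : (0 : ℝ) < d + 1 := by positivity
  have hE : ∀ g t f, (#(E g t f) : ℝ) ≤ O * ((n : ℝ) ^ 2) ^ (g + 1) / (((d : ℝ) + 1) ^ 2) ^ (g + 1) := by
    intro g t f
    rw [le_div_iff₀ (by positivity)]
    by_cases hf : List.ofFn f ≠ [] ∧ (t :: (List.ofFn f).map Prod.fst).Nodup ∧
        ProperSteps J (List.ofFn f)
    · have h1 := card_chain_mul_le (Y := Y) hf.1 hf.2.1 hf.2.2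
      rw [List.length_ofFn] at h1
      have h2 : #(E g t f) * ((d + 1) ^ 2) ^ (g + 1) ≤ O * (n ^ 2) ^ (g + 1) := by
        refine le_trans (Nat.mul_le_mul_right _ (card_le_card fun h hh => ?_)) h1
        simp only [E, mem_filter, mem_univ, true_and] at hh ⊢
        exact hh.2.2.2
      exact_mod_cast h2
    · have : E g t f = ∅ := by
        refine filter_eq_empty_iff.2 fun h _ hh => hf ⟨hh.1, hh.2.1, hh.2.2.1⟩
      rw [this]
      simp only [card_empty, Nat.cast_zero, zero_mul]
      positivity
  have hsub : ({h : (Fin (d + 1) → Fin b) → Y → Fin (d + 1) | ¬ IsGoodPoint h G J} :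
      Finset ((Fin (d + 1) → Fin b) → Y → Fin (d + 1))) ⊆
      ({h : (Fin (d + 1) → Fin b) → Y → Fin (d + 1) | ¬ (h J).Injective} :
        Finset ((Fin (d + 1) → Fin b) → Y → Fin (d + 1))) ∪
      (range G).biUnion fun g => univ.biUnion fun t => univ.biUnion fun f => E (g + 1) t f := by
    intro h hh
    simp only [mem_filter, mem_univ, true_and, IsGoodPoint, not_and_or] at hh
    simp only [mem_union, mem_filter, mem_univ, true_and, mem_biUnion]
    refine hh.imp id fun hh => ?_
    push Not at hh
    obtain ⟨t, l, hl, hlG, hnd, hJ, hx⟩ := hh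
    have hofFn : ∀ m, l.length = m → ∃ f : Fin m → Fin (d + 1) × Fin b, List.ofFn f = l := by
      rintro _ rfl
      exact ⟨l.get, List.ofFn_get l⟩
    obtain ⟨g, hg⟩ := Nat.exists_eq_succ_of_ne_zero (fun h => hl (List.length_eq_zero_iff.1 h))
    obtain ⟨f, rfl⟩ := hofFn _ hg
    exact ⟨g, by simp at hlG ⊢; omega, t, f, by
      simp only [E, mem_filter, mem_univ, true_and]
      exact ⟨hl, hnd, hJ, hx⟩⟩
  have h0 : (#{h : (Fin (d + 1) → Fin b) → Y → Fin (d + 1) | ¬ (h J).Injective} : ℝ) ≤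
      O / (d + 1) * n ^ 2 := by
    rw [div_mul_eq_mul_div, le_div_iff₀ hT]
    exact_mod_cast card_not_injective_apply_mul_le (Y := Y) J
  have h1 : (#((range G).biUnion fun g => univ.biUnion fun t => univ.biUnion fun f =>
      E (g + 1) t f) : ℝ) ≤ ∑ g ∈ range G, O / (d + 1) * ((C : ℝ) ^ (g + 1) * (n ^ 2) ^ (g + 2)) := by
    calc (#((range G).biUnion fun g => univ.biUnion fun t => univ.biUnion fun f =>
          E (g + 1) t f) : ℝ)
        ≤ ∑ g ∈ range G, ∑ t : Fin (d + 1), ∑ f : Fin (g + 1) → Fin (d + 1) × Fin b,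
            (#(E (g + 1) t f) : ℝ) := by
          exact_mod_cast card_biUnion_le.trans (sum_le_sum fun g _ => card_biUnion_le.trans
            (sum_le_sum fun t _ => card_biUnion_le))
      _ ≤ ∑ g ∈ range G, ∑ t : Fin (d + 1), ∑ f : Fin (g + 1) → Fin (d + 1) × Fin b,
            O * ((n : ℝ) ^ 2) ^ (g + 2) / (((d : ℝ) + 1) ^ 2) ^ (g + 2) :=
          sum_le_sum fun g _ => sum_le_sum fun t _ => sum_le_sum fun f _ => hE _ _ _
      _ = _ := by
          refine sum_congr rfl fun g _ => ?_
          simp only [sum_const, card_univ, Fintype.card_fin, Fintype.card_fun, Fintype.card_prod,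
            nsmul_eq_mul, hb]
          push_cast
          generalize (d : ℝ) + 1 = T at hT
          field_simp
          ring
  calc (#{h : (Fin (d + 1) → Fin b) → Y → Fin (d + 1) | ¬ IsGoodPoint h G J} : ℝ)
      ≤ (#{h : (Fin (d + 1) → Fin b) → Y → Fin (d + 1) | ¬ (h J).Injective} : ℝ) +
        (#((range G).biUnion fun g => univ.biUnion fun t => univ.biUnion fun f =>
          E (g + 1) t f) : ℝ) := by
        exact_mod_cast (card_le_card hsub).trans (card_union_le _ _)
    _ ≤ O / (d + 1) * n ^ 2 +
        ∑ g ∈ range G, O / (d + 1) * ((C : ℝ) ^ (g + 1) * (n ^ 2) ^ (g + 2)) := add_le_add h0 h1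
    _ = O / (d + 1) * ∑ g ∈ range (G + 1), (C : ℝ) ^ g * (n ^ 2) ^ (g + 1) := by
        rw [sum_range_succ', mul_add, mul_sum]
        simp only [pow_zero, one_mul, zero_add, pow_one]
        rw [add_comm]

end Chains

/-! ### Random directions defeat every colouring of the lines -/

/-- The line of the grid through `J` in direction `t`, encoded by its direction and by the
coordinates that are constant along it. -/
def lineThrough {d b : ℕ} (J : Fin (d + 1) → Fin b) (t : Fin (d + 1)) :
    Fin (d + 1) × (Fin d → Fin b) :=
  (t, t.removeNth J)

/-- There are a grid and directions `h J y` at its points such that, for every colouring of the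
axis-parallel lines, some good point sees only one colour on the lines in its directions. -/
theorem exists_directions (Y : Type*) [Fintype Y] [DecidableEq Y] [Nonempty Y] {k : ℕ}
    (hk : 0 < k) (G : ℕ) :
    ∃ (d b : ℕ) (h : (Fin (d + 1) → Fin b) → Y → Fin (d + 1)),
      ∀ ψ : Fin (d + 1) × (Fin d → Fin b) → Fin k,
        ∃ J, IsGoodPoint h G J ∧ ∃ c, ∀ y, ψ (lineThrough J (h J y)) = c := by
  classical
  set n := Fintype.card Y with hn
  have hkR : (0 : ℝ) < k := by exact_mod_cast hk
  -- A point sees a single colour with probability at least `q`.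
  obtain ⟨q, hq⟩ : ∃ q : ℝ, q = 1 / (k : ℝ) ^ n := ⟨_, rfl⟩
  have hq0 : 0 < q := by rw [hq]; positivity
  have hq1 : q ≤ 1 := by
    rw [hq, div_le_one (by positivity)]
    exact one_le_pow₀ (by exact_mod_cast hk)
  -- `C` is the number of points per line; it beats the number of colourings of the lines.
  obtain ⟨C, hC⟩ : ∃ C : ℕ, (1 - q / 2) ^ C < 1 / (4 * k) :=
    exists_pow_lt_of_lt_one (by positivity) (by linarith)
  set A : ℝ := ∑ g ∈ range (G + 1), (C : ℝ) ^ g * ((n : ℝ) ^ 2) ^ (g + 1) with hA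
  have hC0 : C ≠ 0 := by
    rintro rfl
    rw [pow_zero, lt_div_iff₀ (by positivity)] at hC
    have : (1 : ℝ) ≤ k := by exact_mod_cast hk
    linarith
  obtain ⟨d, hd⟩ := exists_nat_ge (4 * C * A)
  obtain ⟨b, hb⟩ : ∃ b, b = C * (d + 1) := ⟨_, rfl⟩
  have hb0 : 0 < b := by rw [hb]; positivity
  set L := (d + 1) * b ^ d with hL
  have hL0 : 0 < L := by positivity
  have hΛ : Fintype.card (Fin (d + 1) → Fin b) = C * L := by
    rw [Fintype.card_fun, Fintype.card_fin, Fintype.card_fin, pow_succ, hL]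
    nth_rw 2 [hb]
    ring
  have hlines : Fintype.card (Fin (d + 1) × (Fin d → Fin b)) = L := by
    rw [Fintype.card_prod, Fintype.card_fun, Fintype.card_fin, Fintype.card_fin, Fintype.card_fin]
  set O := Fintype.card ((Fin (d + 1) → Fin b) → Y → Fin (d + 1)) with hO
  have hO0 : (0 : ℝ) < O := by
    rw [hO]
    exact_mod_cast Fintype.card_pos
  let F : (Fin (d + 1) × (Fin d → Fin b) → Fin k) → (Fin (d + 1) → Fin b) →
      Finset (Y → Fin (d + 1)) := fun ψ J => {f | ∃ c, ∀ y, ψ (lineThrough J (f y)) = c}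
  let B₁ : Finset ((Fin (d + 1) → Fin b) → Y → Fin (d + 1)) :=
    {h | L < #{J | ¬ IsGoodPoint h G J}}
  let B₂ : Finset ((Fin (d + 1) → Fin b) → Y → Fin (d + 1)) :=
    univ.biUnion fun ψ => {h | #{J | h J ∈ F ψ J} ≤ L}
  have hB₁ : (#B₁ : ℝ) ≤ O / 4 := by
    have h1 : (#B₁ : ℝ) * L ≤ ∑ h : (Fin (d + 1) → Fin b) → Y → Fin (d + 1),
        (#{J | ¬ IsGoodPoint h G J} : ℝ) := by
      calc (#B₁ : ℝ) * L = ∑ h ∈ B₁, (L : ℝ) := by rw [sum_const, nsmul_eq_mul]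
        _ ≤ ∑ h ∈ B₁, (#{J | ¬ IsGoodPoint h G J} : ℝ) := sum_le_sum fun h hh => by
          exact_mod_cast (mem_filter.1 hh).2.le
        _ ≤ _ := sum_le_sum_of_subset_of_nonneg (subset_univ _) fun _ _ _ => by positivity
    have h2 : ∑ h : (Fin (d + 1) → Fin b) → Y → Fin (d + 1),
        (#{J | ¬ IsGoodPoint h G J} : ℝ) = ∑ J : Fin (d + 1) → Fin b,
          (#{h : (Fin (d + 1) → Fin b) → Y → Fin (d + 1) | ¬ IsGoodPoint h G J} : ℝ) := by
      simp only [card_filter, Nat.cast_sum]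
      exact sum_comm
    have h3 : ∑ J : Fin (d + 1) → Fin b,
        (#{h : (Fin (d + 1) → Fin b) → Y → Fin (d + 1) | ¬ IsGoodPoint h G J} : ℝ) ≤
        C * L * (O / (d + 1) * A) := by
      refine (sum_le_sum fun J _ => card_not_isGoodPoint_le C G hb J).trans ?_
      rw [sum_const, card_univ, hΛ, nsmul_eq_mul, Nat.cast_mul]
    have hd' : 4 * C * A ≤ (d : ℝ) + 1 := by linarith
    have hLR : (0 : ℝ) < L := by exact_mod_cast hL0
    have h4 : (C : ℝ) * L * (O / (d + 1) * A) ≤ O / 4 * L := by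
      rw [div_mul_eq_mul_div, mul_div_assoc', div_le_iff₀ (by positivity)]
      nlinarith [mul_pos hLR hO0]
    exact le_of_mul_le_mul_right (h1.trans (h2.le.trans (h3.trans h4))) hLR
  have hB₂ : (#B₂ : ℝ) ≤ O / 2 := by
    have hF : ∀ ψ J, q * Fintype.card (Y → Fin (d + 1)) ≤ #(F ψ J) := by
      intro ψ J
      rw [hq, one_div, inv_mul_le_iff₀ (by positivity), mul_comm]
      exact_mod_cast card_pow_le_card_monochromatic_mul (Y := Y)
        (fun t => ψ (lineThrough J t)) (by simp)
    calc (#B₂ : ℝ) ≤ ∑ ψ : Fin (d + 1) × (Fin d → Fin b) → Fin k,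
          (#{h : (Fin (d + 1) → Fin b) → Y → Fin (d + 1) | #{J | h J ∈ F ψ J} ≤ L} : ℝ) := by
          exact_mod_cast card_biUnion_le
      _ ≤ ∑ ψ : Fin (d + 1) × (Fin d → Fin b) → Fin k,
          (2 : ℝ) ^ L * (O * (1 - q / 2) ^ (C * L)) := sum_le_sum fun ψ _ => by
          rw [← hΛ]
          exact card_few_mem_le (F ψ) (hF ψ) L
      _ = O * (2 * k * (1 - q / 2) ^ C) ^ L := by
          rw [sum_const, card_univ, Fintype.card_fun, hlines, Fintype.card_fin, nsmul_eq_mul,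
            Nat.cast_pow, pow_mul, mul_pow, mul_pow]
          ring
      _ ≤ O * (1 / 2) ^ L := by
          have h1 : 0 ≤ (1 - q / 2) ^ C := pow_nonneg (by linarith) _
          gcongr
          rw [lt_div_iff₀ (by positivity)] at hC
          linarith
      _ ≤ O * (1 / 2) ^ 1 := by
          gcongr ?_ * ?_
          exact pow_le_pow_of_le_one (by norm_num) (by norm_num) hL0
      _ = O / 2 := by ring
  obtain ⟨h, hh⟩ : ∃ h, h ∉ B₁ ∪ B₂ := by
    by_contra! hcon
    have h1 : O ≤ #B₁ + #B₂ := by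
      rw [hO, ← card_univ]
      exact (card_le_card fun h _ => hcon h).trans (card_union_le _ _)
    have h2 : (O : ℝ) ≤ #B₁ + #B₂ := by exact_mod_cast h1
    linarith
  simp only [mem_union, not_or, B₁, B₂, mem_filter, mem_univ, true_and, mem_biUnion, not_lt,
    not_exists, not_le] at hh
  refine ⟨d, b, h, fun ψ => ?_⟩
  by_contra! hcon
  refine absurd (hh.2 ψ) (not_lt.2 (le_trans (card_le_card fun J hJ => ?_) hh.1))
  simp only [mem_filter, mem_univ, true_and, F] at hJ ⊢
  intro hgood
  obtain ⟨c, hc⟩ := hJ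
  obtain ⟨y, hy⟩ := hcon J hgood c
  exact hy (hc y)

/-! ### The grid graph -/

/-- The vertices of the grid graph: the axis-parallel lines of the grid `Fin (d + 1) → Fin b`,
encoded as in `lineThrough`, and one copy `leaf J` of `Y` for every grid point `J`. -/
inductive GridVertex (d b : ℕ) (Y : Type*)
  | line (e : Fin (d + 1) × (Fin d → Fin b)) : GridVertex d b Y
  | leaf (J : Fin (d + 1) → Fin b) (y : Y) : GridVertex d b Y

namespace GridVertex

variable {d b : ℕ} {Y : Type*}

instance [Finite Y] : Finite (GridVertex d b Y) :=
  Finite.of_injective (β := (Fin (d + 1) × (Fin d → Fin b)) ⊕ (Fin (d + 1) → Fin b) × Y)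
    (fun v => match v with
      | line e => Sum.inl e
      | leaf J y => Sum.inr (J, y))
    (by rintro (_ | _) (_ | _) h <;> simp_all)

/-- The direction of a line; the other vertices have no direction. -/
def dir : GridVertex d b Y → Option (Fin (d + 1))
  | line e => some e.1
  | leaf _ _ => none

/-- The grid coordinates of a vertex. A line has the coordinate `⊥` in its own direction. -/
def coord : GridVertex d b Y → Fin (d + 1) → WithBot (Fin b)
  | line e => e.1.insertNth ⊥ fun j => (e.2 j : WithBot (Fin b))
  | leaf J _ => fun s => (J s : WithBot (Fin b))

/-- The position of a vertex in `Y`; it is `⊥` for a line. -/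
def position : GridVertex d b Y → WithBot Y
  | line _ => ⊥
  | leaf _ y => y

theorem coord_eq_bot_iff {v : GridVertex d b Y} {s : Fin (d + 1)} :
    v.coord s = ⊥ ↔ v.dir = some s := by
  cases v with
  | line e =>
    rcases Fin.eq_self_or_eq_succAbove e.1 s with h | ⟨j, h⟩
    · simp [coord, dir, h]
    · simp [coord, dir, h, Fin.ne_succAbove]
  | leaf J y => simp [coord, dir]

/-- The lexicographic sort key of a vertex. -/
def sortKey (v : GridVertex d b Y) : Lex (Fin (d + 1) → WithBot (Fin b)) ×ₗ WithBot Y :=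
  toLex (toLex v.coord, v.position)

theorem sortKey_injective : (sortKey : GridVertex d b Y → _).Injective := by
  intro v w h
  have h' : v.coord = w.coord ∧ v.position = w.position := by
    simpa [sortKey] using h
  obtain ⟨hc, hp⟩ := h'
  cases v with
  | line e =>
    cases w with
    | line e' =>
      obtain ⟨t, x⟩ := e
      obtain ⟨t', x'⟩ := e'
      have ht : t = t' := by
        have h1 : (line (t', x') : GridVertex d b Y).coord t = ⊥ := by
          rw [← hc, coord_eq_bot_iff]
          rfl
        rw [coord_eq_bot_iff] at h1
        exact (Option.some.inj h1).symm
      subst ht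
      congr 2
      funext j
      have := congrFun hc (t.succAbove j)
      simpa [coord] using this
    | leaf J y => simp [position] at hp
  | leaf J y =>
    cases w with
    | line e' => simp [position] at hp
    | leaf J' y' =>
      have hJ : J = J' := funext fun s => by simpa [coord] using congrFun hc s
      have hy : y = y' := by simpa [position] using hp
      rw [hJ, hy]

/-- The vertices are ordered lexicographically: by their grid coordinates first, then by their
position in `Y`. -/
noncomputable instance [LinearOrder Y] : LinearOrder (GridVertex d b Y) :=
  LinearOrder.lift' sortKey sortKey_injective

theorem lt_of_coord_lt [LinearOrder Y] {v w : GridVertex d b Y} {t : Fin (d + 1)}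
    (h : ∀ s < t, v.coord s = w.coord s) (ht : v.coord t < w.coord t) : v < w := by
  change sortKey v < sortKey w
  rw [sortKey, sortKey, Prod.Lex.toLex_lt_toLex]
  exact Or.inl ⟨t, h, ht⟩

theorem leaf_lt_leaf [LinearOrder Y] {J : Fin (d + 1) → Fin b} {y z : Y} :
    leaf J y < leaf J z ↔ y < z := by
  change sortKey (leaf J y) < sortKey (leaf J z) ↔ _
  rw [sortKey, sortKey, Prod.Lex.toLex_lt_toLex]
  constructor
  · rintro (hlt | ⟨-, hlt⟩)
    · exact absurd hlt (lt_irrefl _)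
    · exact WithBot.coe_lt_coe.1 hlt
  · exact fun hlt => Or.inr ⟨rfl, WithBot.coe_lt_coe.2 hlt⟩

theorem filterMap_dir_line (e : Fin (d + 1) × (Fin d → Fin b)) (l : List (GridVertex d b Y)) :
    (line e :: l).filterMap dir = e.1 :: l.filterMap dir := rfl

end GridVertex

open GridVertex

/-- The grid graph: the copies of `GY` at the grid points, with `leaf J y` joined, at the good
points `J`, to the line through `J` in direction `h J y`. -/
def gridGraph {d b : ℕ} {Y : Type*} (h : (Fin (d + 1) → Fin b) → Y → Fin (d + 1)) (G : ℕ)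
    (GY : SimpleGraph Y) : SimpleGraph (GridVertex d b Y) where
  Adj
    | line _, line _ => False
    | line e, leaf J y => IsGoodPoint h G J ∧ e = lineThrough J (h J y)
    | leaf J y, line e => IsGoodPoint h G J ∧ e = lineThrough J (h J y)
    | leaf J y, leaf J' y' => J = J' ∧ GY.Adj y y'
  symm := ⟨by
    rintro (_ | _) (_ | _) h
    · exact h
    · exact h
    · exact h
    · exact ⟨h.1.symm, h.2.symm⟩⟩
  loopless := ⟨by
    rintro (_ | _) h
    · exact h
    · exact GY.loopless.irrefl _ h.2⟩

section GridGraph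

variable {d b G : ℕ} {Y : Type*} {h : (Fin (d + 1) → Fin b) → Y → Fin (d + 1)}
  {GY : SimpleGraph Y}

theorem coord_line_lineThrough {J : Fin (d + 1) → Fin b} {s t : Fin (d + 1)} (hs : s ≠ t) :
    (line (lineThrough J t) : GridVertex d b Y).coord s = J s := by
  obtain ⟨j, rfl⟩ := Fin.exists_succAbove_eq hs
  simp [coord, lineThrough, Fin.removeNth]

theorem eq_update_of_lineThrough_eq {J J' : Fin (d + 1) → Fin b} {s s' : Fin (d + 1)}
    (hJ : lineThrough J s = lineThrough J' s') : J' = Function.update J s (J' s) := by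
  obtain ⟨rfl, h2⟩ := Prod.mk.inj hJ
  funext r
  rcases Fin.eq_self_or_eq_succAbove s r with rfl | ⟨j, rfl⟩
  · simp
  · rw [Function.update_of_ne (Fin.succAbove_ne _ _)]
    exact (congrFun h2 j).symm

theorem coord_eq_of_adj {v w : GridVertex d b Y} {s : Fin (d + 1)}
    (hvw : (gridGraph h G GY).Adj v w) (hv : v.dir ≠ some s) (hw : w.dir ≠ some s) :
    v.coord s = w.coord s := by
  cases v with
  | line e =>
    cases w with
    | line e' => exact hvw.elim
    | leaf J y =>
      obtain ⟨-, rfl⟩ := hvw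
      rw [coord_line_lineThrough (t := h J y) fun hs => hv (congrArg some hs.symm)]
      rfl
  | leaf J y =>
    cases w with
    | line e =>
      obtain ⟨-, rfl⟩ := hvw
      rw [coord_line_lineThrough (t := h J y) fun hs => hw (congrArg some hs.symm)]
      rfl
    | leaf J' y' =>
      obtain ⟨rfl, -⟩ := hvw
      rfl

theorem coord_eq_of_isChain {l : List (GridVertex d b Y)} {s : Fin (d + 1)}
    (hl : l.IsChain (gridGraph h G GY).Adj) (hs : s ∉ l.filterMap dir)
    {v w : GridVertex d b Y} (hv : v ∈ l) (hw : w ∈ l) : v.coord s = w.coord s := by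
  induction l generalizing v w with
  | nil => simp at hv
  | cons a l ih =>
    have hd : ∀ z ∈ a :: l, z.dir ≠ some s := fun z hz hzs =>
      hs (List.mem_filterMap.2 ⟨z, hz, hzs⟩)
    have hs' : s ∉ l.filterMap dir := fun hmem => by
      obtain ⟨z, hz, hzs⟩ := List.mem_filterMap.1 hmem
      exact hd z (List.mem_cons_of_mem _ hz) hzs
    have ha : ∀ z ∈ a :: l, z.coord s = a.coord s := by
      intro z hz
      rcases List.mem_cons.1 hz with rfl | hz
      · rfl
      cases l with
      | nil => simp at hz
      | cons c l =>
        rw [List.isChain_cons_cons] at hl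
        rw [ih hl.2 hs' hz List.mem_cons_self]
        exact (coord_eq_of_adj hl.1 (hd a List.mem_cons_self)
          (hd c (List.mem_cons_of_mem _ List.mem_cons_self))).symm
    rw [ha v hv, ha w hw]

/-- A line has at most one neighbour with a given coordinate in its direction. -/
theorem eq_of_adj_line {e : Fin (d + 1) × (Fin d → Fin b)} {v w : GridVertex d b Y}
    (hv : (gridGraph h G GY).Adj (line e) v) (hw : (gridGraph h G GY).Adj (line e) w)
    (hvw : v.coord e.1 = w.coord e.1) : v = w := by
  cases v with
  | line e' => exact hv.elim
  | leaf J y =>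
    cases w with
    | line e' => exact hw.elim
    | leaf J' y' =>
      obtain ⟨hJ, rfl⟩ := hv
      obtain ⟨-, hw⟩ := hw
      have h1 : J (h J y) = J' (h J y) := by simpa [coord, lineThrough] using hvw
      have hJJ : J' = J := by
        rw [eq_update_of_lineThrough_eq hw, ← h1, Function.update_eq_self]
      subst hJJ
      rw [hJ.1 (Prod.mk.inj hw).1]

/-- A path without lines lies in the copy of `GY` at one grid point. -/
theorem exists_eq_map_leaf {l : List (GridVertex d b Y)}
    (hl : l.IsChain (gridGraph h G GY).Adj) (h0 : l.filterMap dir = []) (hne : l ≠ []) :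
    ∃ (J : _) (ys : List Y), l = ys.map (leaf J) := by
  cases l with
  | nil => exact absurd rfl hne
  | cons a l =>
    cases a with
    | line e => simp [dir] at h0
    | leaf J y =>
      refine ⟨J, ?_⟩
      have : ∀ v ∈ leaf J y :: l, ∃ z, leaf J z = v := by
        intro v hv
        cases v with
        | line e =>
          have : e.1 ∈ (leaf J y :: l).filterMap dir := List.mem_filterMap.2 ⟨_, hv, rfl⟩
          rw [h0] at this
          simp at this
        | leaf J' z =>
          refine ⟨z, ?_⟩
          have hJ : J = J' := funext fun s => by
            simpa [coord] using coord_eq_of_isChain (s := s) hl (by simp [h0]) List.mem_cons_self hv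
          rw [hJ]
      obtain ⟨ys, hys⟩ : leaf J y :: l ∈ Set.range (List.map (leaf J)) := by
        rw [Set.range_list_map]
        exact this
      exact ⟨ys, hys.symm⟩

/-- A path between two leaves whose lines have distinct directions traces out a chain of grid
points in the sense of `IsGoodPoint`. -/
theorem exists_chainTriples_of_isChain {t p : Fin (d + 1)} {J J' : Fin (d + 1) → Fin b} {y y' : Y}
    (B : List (GridVertex d b Y)) (hB : (leaf J y :: B).IsChain (gridGraph h G GY).Adj)
    (hnd : (leaf J y :: B).Nodup) (hlast : (leaf J y :: B).getLast? = some (leaf J' y'))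
    (hp : p ∈ Set.range (h J)) (ht : t ∈ Set.range (h J')) :
    ∃ l : List (Fin (d + 1) × Fin b), l.map Prod.fst = B.filterMap dir ∧ ProperSteps J l ∧
      ∀ x ∈ chainTriples t J p l, x.2.1 ∈ Set.range (h x.1) ∧ x.2.2 ∈ Set.range (h x.1) := by
  match B with
  | [] =>
    obtain ⟨rfl, rfl⟩ : J = J' ∧ y = y' := by simpa using hlast
    exact ⟨[], rfl, trivial, by simpa [chainTriples] using ⟨hp, ht⟩⟩
  | leaf J₂ y₂ :: B =>
    rw [List.isChain_cons_cons] at hB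
    obtain ⟨⟨rfl, -⟩, hB⟩ := hB
    rw [List.getLast?_cons_cons] at hlast
    obtain ⟨l, hl⟩ := exists_chainTriples_of_isChain B hB (List.nodup_cons.1 hnd).2 hlast hp ht
    exact ⟨l, hl⟩
  | [line e] => simp at hlast
  | line e :: line e' :: B =>
    simp only [List.isChain_cons_cons] at hB
    exact hB.2.1.elim
  | line e :: leaf J₂ y₂ :: B =>
    simp only [List.isChain_cons_cons] at hB
    obtain ⟨h1, h2, hB⟩ := hB
    rw [List.getLast?_cons_cons, List.getLast?_cons_cons] at hlast
    have hne : leaf J y ≠ leaf J₂ y₂ := fun hh => by simp [hh] at hnd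
    have hJ₂ : J (h J y) ≠ J₂ (h J y) := fun hh =>
      hne (eq_of_adj_line h1.symm h2 (by
        obtain ⟨-, rfl⟩ := h1
        simpa [coord, lineThrough] using hh))
    obtain ⟨-, rfl⟩ := h1
    obtain ⟨-, h2⟩ := h2
    obtain ⟨l, hl, hp', hx⟩ := exists_chainTriples_of_isChain (p := h J y) B hB
      (List.nodup_cons.1 (List.nodup_cons.1 hnd).2).2 hlast ⟨y₂, (Prod.mk.inj h2).1.symm⟩ ht
    have hup : Function.update J (h J y) (J₂ (h J y)) = J₂ := (eq_update_of_lineThrough_eq h2).symm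
    refine ⟨(h J y, J₂ (h J y)) :: l, ?_, ⟨hJ₂, ?_⟩, ?_⟩
    · simp [List.filterMap_cons, dir, hl, lineThrough]
    · rwa [hup]
    · intro x hx'
      rcases List.mem_cons.1 hx' with rfl | hx'
      · exact ⟨hp, y, rfl⟩
      · rw [hup] at hx'
        exact hx x hx'

/-- The lines on a short path have distinct directions: the part of the path between two lines of
the same direction would be a chain forbidden at good points. -/
theorem nodup_filterMap_dir {l : List (GridVertex d b Y)}
    (hl : l.IsChain (gridGraph h G GY).Adj) (hnd : l.Nodup) (hG : l.length ≤ G) :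
    (l.filterMap dir).Nodup := by
  induction l with
  | nil => simp
  | cons a l ih =>
    have hdl := ih hl.tail (List.nodup_cons.1 hnd).2 (by simp at hG; omega)
    cases a with
    | leaf J y => simpa [List.filterMap_cons, dir] using hdl
    | line e =>
      rw [filterMap_dir_line, List.nodup_cons]
      refine ⟨fun hmem => ?_, hdl⟩
      obtain ⟨w, hw, hwe⟩ := List.mem_filterMap.1 hmem
      cases w with
      | leaf J y => simp [dir] at hwe
      | line e' =>
        have he : e'.1 = e.1 := Option.some.inj hwe
        obtain ⟨B, C, rfl⟩ := List.append_of_mem hw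
        rw [List.filterMap_append, filterMap_dir_line, he,
          List.nodup_append] at hdl
        have htB : e.1 ∉ B.filterMap dir := fun hB => hdl.2.2 _ hB _ List.mem_cons_self rfl
        have hchain : (line e :: (B ++ [line e'])).IsChain (gridGraph h G GY).Adj := by
          refine hl.infix ⟨[], C, ?_⟩
          simp
        have hee : e ≠ e' := fun hh => by simp [hh] at hnd
        cases B with
        | nil =>
          simp only [List.nil_append, List.isChain_cons_cons] at hchain
          exact hchain.1.elim
        | cons a B =>
          cases a with
          | line e'' =>
            simp only [List.cons_append, List.isChain_cons_cons] at hchain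
            exact hchain.1.elim
          | leaf J y =>
            have h1 : (gridGraph h G GY).Adj (line e) (leaf J y) := by
              simp only [List.cons_append, List.isChain_cons_cons] at hchain
              exact hchain.1
            have hB : (leaf J y :: B).IsChain (gridGraph h G GY).Adj :=
              hchain.infix ⟨[line e], [line e'], by simp⟩
            have hBnd : (leaf J y :: B).Nodup := by
              have := (List.nodup_cons.1 hnd).2
              exact (List.nodup_append.1 this).1
            obtain ⟨z, hz⟩ : ∃ z, (leaf J y :: B).getLast? = some z :=
              Option.isSome_iff_exists.1 (by simp)
            have h2 : (gridGraph h G GY).Adj z (line e') := by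
              have h3 := hchain.tail
              rw [List.tail_cons, List.isChain_append] at h3
              exact h3.2.2 z hz _ rfl
            cases z with
            | line _ => exact h2.elim
            | leaf J' y' =>
              obtain ⟨hJ, rfl⟩ := h1
              obtain ⟨-, rfl⟩ := h2
              obtain ⟨l, hl1, hl2, hl3⟩ := exists_chainTriples_of_isChain (p := h J y)
                (t := h J y) B hB hBnd hz ⟨y, rfl⟩ ⟨y', he⟩
              have hdirs : (leaf J y :: B).filterMap dir = B.filterMap dir := rfl
              by_cases hl0 : l = []
              · rw [hl0, List.map_nil] at hl1
                obtain ⟨J₀, ys, hys⟩ := exists_eq_map_leaf hB (hdirs.trans hl1.symm)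
                  (List.cons_ne_nil _ _)
                have hm : leaf J y ∈ ys.map (leaf J₀) := hys ▸ List.mem_cons_self
                have hm' : leaf J' y' ∈ ys.map (leaf J₀) := hys ▸ List.mem_of_getLast? hz
                simp only [List.mem_map, leaf.injEq] at hm hm'
                obtain ⟨-, -, rfl, -⟩ := hm
                obtain ⟨-, -, rfl, -⟩ := hm'
                exact hee (congrArg (lineThrough _) he.symm)
              · refine hJ.2 (h J y) l hl0 ?_ ?_ hl2 hl3
                · have := List.length_filterMap_le dir B
                  rw [← hl1, List.length_map] at this
                  simp at hG
                  omega
                · rw [hl1, List.nodup_cons]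
                  exact ⟨htB, hdl.1⟩

theorem dir_ne_of_nodup {l : List (GridVertex d b Y)} (hl : (l.filterMap dir).Nodup)
    {e : Fin (d + 1) × (Fin d → Fin b)} (he : line e ∈ l) {v : GridVertex d b Y} (hv : v ∈ l)
    (hve : v ≠ line e) : v.dir ≠ some e.1 := by
  intro hd
  obtain ⟨A, B, rfl⟩ := List.append_of_mem he
  rw [List.filterMap_append, filterMap_dir_line, List.nodup_append,
    List.nodup_cons] at hl
  simp only [List.mem_append, List.mem_cons, hve, false_or] at hv
  rcases hv with hv | hv
  · exact hl.2.2 _ (List.mem_filterMap.2 ⟨v, hv, hd⟩) _ List.mem_cons_self rfl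
  · exact hl.2.1.1 (List.mem_filterMap.2 ⟨v, hv, hd⟩)

end GridGraph

/-! ### Ordered graphs without short cycles and with separated branches -/

/-- `G` has no cycle with at most `ℓ` vertices, and in every path with at most `ℓ` vertices the
leftmost vertex `u` separates the path into a left and a right part: of the two branches `l₁` and
`l₂` that leave `u`, one precedes the other. -/
def HasSeparatedBranches (G : OrderedGraph.{u}) (ℓ : ℕ) : Prop :=
  (∀ l : List G.V, 3 ≤ l.length → l.length ≤ ℓ → l.Nodup → ¬ (l : Cycle G.V).Chain G.graph.Adj) ∧
    ∀ (u : G.V) (l₁ l₂ : List G.V), (l₁.reverse ++ u :: l₂).IsChain G.graph.Adj →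
      (l₁.reverse ++ u :: l₂).Nodup → (l₁.reverse ++ u :: l₂).length ≤ ℓ →
      (∀ x ∈ l₁ ++ l₂, u < x) →
      (∀ x ∈ l₁, ∀ y ∈ l₂, x < y) ∨ ∀ x ∈ l₁, ∀ y ∈ l₂, y < x

section Separated

variable {d b ℓ : ℕ} (Y : OrderedGraph.{u}) (h : (Fin (d + 1) → Fin b) → Y.V → Fin (d + 1))

/-- The grid graph as an ordered graph. -/
noncomputable def grid (ℓ : ℕ) : OrderedGraph.{u} where
  V := GridVertex d b Y.V
  graph := gridGraph h ℓ Y.graph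

variable {Y} {h}

theorem isChain_map_leaf {J : Fin (d + 1) → Fin b} {ys : List Y.V} :
    (ys.map (leaf J)).IsChain (gridGraph h ℓ Y.graph).Adj ↔ ys.IsChain Y.graph.Adj := by
  rw [List.isChain_map]
  refine iff_of_eq (congrArg (List.IsChain · ys) ?_)
  funext y z
  simp [gridGraph]

theorem not_chain_grid (hY : Y.HasSeparatedBranches ℓ) {l : List (GridVertex d b Y.V)}
    (h3 : 3 ≤ l.length) (hℓ : l.length ≤ ℓ) (hnd : l.Nodup) :
    ¬ (l : Cycle (GridVertex d b Y.V)).Chain (gridGraph h ℓ Y.graph).Adj := by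
  intro hl
  by_cases h0 : l.filterMap dir = []
  · cases l with
    | nil => simp at h3
    | cons a l =>
      rw [Cycle.chain_coe_cons] at hl
      obtain ⟨J, ys, hys⟩ := exists_eq_map_leaf
        (hl.infix (l₁ := a :: l) ⟨[], [a], by simp⟩) h0 (List.cons_ne_nil _ _)
      cases ys with
      | nil => simp at hys
      | cons y ys =>
        rw [List.map_cons] at hys
        obtain ⟨rfl, rfl⟩ := List.cons.inj hys
        refine hY.1 (y :: ys) (by simpa using h3) (by simpa using hℓ)
          (List.Nodup.of_map (leaf J) (by simpa using hnd)) ?_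
        rw [Cycle.chain_coe_cons, ← isChain_map_leaf (J := J) (h := h) (ℓ := ℓ)]
        simpa using hl
  · obtain ⟨t, ht⟩ := List.exists_mem_of_ne_nil _ h0
    obtain ⟨e, he⟩ : ∃ e, line e ∈ l := by
      obtain ⟨v, hv, hvt⟩ := List.mem_filterMap.1 ht
      cases v with
      | line e => exact ⟨e, hv⟩
      | leaf J y => simp [dir] at hvt
    -- Rotate the cycle so that it starts at a line.
    obtain ⟨A, B, rfl⟩ := List.append_of_mem he
    have hrot : (A ++ line e :: B).IsRotated (line e :: (B ++ A)) := by
      rw [← List.cons_append]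
      exact List.isRotated_append
    rw [Cycle.coe_eq_coe.2 hrot] at hl
    rw [hrot.nodup_iff] at hnd
    rw [hrot.perm.length_eq] at h3 hℓ
    generalize B ++ A = l at *
    rw [Cycle.chain_coe_cons] at hl
    have hl1 : (line e :: l).IsChain (gridGraph h ℓ Y.graph).Adj :=
      hl.infix ⟨[], [line e], by simp⟩
    have hdirs := nodup_filterMap_dir hl1 hnd hℓ
    rw [filterMap_dir_line, List.nodup_cons] at hdirs
    match l with
    | [] => simp at h3
    | v :: l =>
      have hv : (gridGraph h ℓ Y.graph).Adj (line e) v := (List.isChain_cons_cons.1 hl1).1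
      obtain ⟨z, hz⟩ : ∃ z, (v :: l).getLast? = some z :=
        Option.isSome_iff_exists.1 (by simp)
      have hz' : (gridGraph h ℓ Y.graph).Adj z (line e) := by
        have h4 := hl.tail
        rw [List.tail_cons, List.isChain_append] at h4
        exact h4.2.2 z hz _ rfl
      have hvz := eq_of_adj_line hv hz'.symm (coord_eq_of_isChain hl1.tail hdirs.1
        List.mem_cons_self (List.mem_of_getLast? hz))
      match l with
      | [] => simp at h3
      | c :: l =>
        rw [List.getLast?_cons_cons] at hz
        have := List.mem_of_getLast? hz
        rw [← hvz] at this
        exact (List.nodup_cons.1 (List.nodup_cons.1 hnd).2).1 this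

/-- The minimal direction of a line on a short path separates the two branches: all coordinates
before it are constant along the path, so that the line is the leftmost vertex of the path, and it
is left on the two sides towards different coordinates. -/
theorem separated_grid (hY : Y.HasSeparatedBranches ℓ) (u : GridVertex d b Y.V)
    (l₁ l₂ : List (GridVertex d b Y.V))
    (hl : (l₁.reverse ++ u :: l₂).IsChain (gridGraph h ℓ Y.graph).Adj)
    (hnd : (l₁.reverse ++ u :: l₂).Nodup) (hℓ : (l₁.reverse ++ u :: l₂).length ≤ ℓ)
    (hu : ∀ x ∈ l₁ ++ l₂, u < x) :
    (∀ x ∈ l₁, ∀ y ∈ l₂, x < y) ∨ ∀ x ∈ l₁, ∀ y ∈ l₂, y < x := by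
  by_cases h0 : (l₁.reverse ++ u :: l₂).filterMap dir = []
  · obtain ⟨J, ys, hys⟩ := exists_eq_map_leaf hl h0 (by simp)
    obtain ⟨ys₁, ys₂, rfl, h1, h2⟩ := List.append_eq_map_iff.1 hys
    obtain ⟨y, ys₂, rfl, rfl, rfl⟩ := List.map_eq_cons_iff.1 h2
    obtain ⟨ys₁, rfl⟩ := List.reverse_surjective ys₁
    rw [List.map_reverse, List.reverse_inj] at h1
    subst h1
    rw [hys, isChain_map_leaf] at hl
    have h3 := hY.2 y ys₁ ys₂ hl (by rw [hys] at hnd; exact hnd.of_map _)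
      (by simpa using hℓ) (fun x hx => by
        refine (leaf_lt_leaf (J := J)).1 (hu _ ?_)
        rw [← List.map_append]
        exact List.mem_map_of_mem hx)
    simpa [leaf_lt_leaf] using h3
  -- The line of minimal direction.
  have hdirs := nodup_filterMap_dir hl hnd hℓ
  obtain ⟨t, ht, htmin⟩ := ((l₁.reverse ++ u :: l₂).filterMap dir).toFinset.exists_minimal
    ((List.toFinset_nonempty_iff _).2 h0)
  obtain ⟨e, he, rfl⟩ : ∃ e, line e ∈ l₁.reverse ++ u :: l₂ ∧ e.1 = t := by
    obtain ⟨v, hv, hvt⟩ := List.mem_filterMap.1 (List.mem_toFinset.1 ht)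
    cases v with
    | line e => exact ⟨e, hv, Option.some.inj hvt⟩
    | leaf J y => simp [dir] at hvt
  have hconst : ∀ v ∈ l₁.reverse ++ u :: l₂, ∀ w ∈ l₁.reverse ++ u :: l₂, ∀ s < e.1,
      v.coord s = w.coord s := fun v hv w hw s hs =>
    coord_eq_of_isChain hl (fun hmem => not_le.2 hs (htmin (List.mem_toFinset.2 hmem) hs.le)) hv hw
  have hmin : ∀ v ∈ l₁.reverse ++ u :: l₂, v ≠ line e → line e < v := by
    intro v hv hve
    refine lt_of_coord_lt (hconst _ he v hv) ?_
    rw [coord_eq_bot_iff.2 rfl, bot_lt_iff_ne_bot, Ne, coord_eq_bot_iff]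
    exact dir_ne_of_nodup hdirs he hv hve
  have hue : u = line e := by
    by_contra hue
    have h1 := hmin u (by simp) hue
    have h2 : line e ∈ l₁ ++ l₂ := by
      have : line e ≠ u := Ne.symm hue
      simpa [this] using he
    exact lt_asymm h1 (hu _ h2)
  subst hue
  have h1 : e.1 ∉ l₁.reverse.filterMap dir := by
    rw [List.filterMap_append, filterMap_dir_line, List.nodup_append] at hdirs
    exact fun hmem => hdirs.2.2 _ hmem _ List.mem_cons_self rfl
  have h2 : e.1 ∉ l₂.filterMap dir := by
    rw [List.filterMap_append, filterMap_dir_line, List.nodup_append,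
      List.nodup_cons] at hdirs
    exact hdirs.2.1.1
  cases l₁ with
  | nil => simp
  | cons v l₁ =>
    cases l₂ with
    | nil => simp
    | cons w l₂ =>
      have hl' := List.isChain_append.1 hl
      have hv : (gridGraph h ℓ Y.graph).Adj (line e) v :=
        (hl'.2.2 v (by simp) (line e) (by simp)).symm
      have hw : (gridGraph h ℓ Y.graph).Adj (line e) w := (List.isChain_cons_cons.1 hl'.2.1).1
      have hvw : v.coord e.1 ≠ w.coord e.1 := fun hh => by
        have := eq_of_adj_line hv hw hh
        have h3 := (List.nodup_append.1 hnd).2.2 v (by simp)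
        exact h3 w (by simp) this
      have hc1 : ∀ x ∈ v :: l₁, x.coord e.1 = v.coord e.1 := fun x hx =>
        coord_eq_of_isChain hl'.1 h1 (List.mem_reverse.2 hx)
          (List.mem_reverse.2 List.mem_cons_self)
      have hc2 : ∀ x ∈ w :: l₂, x.coord e.1 = w.coord e.1 := fun x hx =>
        coord_eq_of_isChain hl'.2.1.tail h2 hx List.mem_cons_self
      have hm1 : ∀ x ∈ v :: l₁, x ∈ (v :: l₁).reverse ++ line e :: w :: l₂ := fun x hx =>
        List.mem_append_left _ (List.mem_reverse.2 hx)
      have hm2 : ∀ x ∈ w :: l₂, x ∈ (v :: l₁).reverse ++ line e :: w :: l₂ := fun x hx =>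
        List.mem_append_right _ (List.mem_cons_of_mem _ hx)
      refine (lt_or_gt_of_ne hvw).imp (fun hlt x hx y hy => ?_) fun hlt x hx y hy => ?_
      · refine lt_of_coord_lt (hconst x (hm1 x hx) y (hm2 y hy)) ?_
        rwa [hc1 x hx, hc2 y hy]
      · refine lt_of_coord_lt (hconst y (hm2 y hy) x (hm1 x hx)) ?_
        rwa [hc1 x hx, hc2 y hy]

theorem hasSeparatedBranches_grid (hY : Y.HasSeparatedBranches ℓ) :
    (grid Y h ℓ).HasSeparatedBranches ℓ :=
  ⟨fun _ h3 hℓ hnd => not_chain_grid hY h3 hℓ hnd, separated_grid hY⟩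

end Separated

/-- In a colouring of the grid graph some good point sees a single colour on its lines, and its
copy of `Y` has to avoid that colour. -/
theorem exists_grid_not_colorable (Y : OrderedGraph.{u}) {m : ℕ} (hY : ¬ Y.graph.Colorable m)
    (ℓ : ℕ) : ∃ (d b : ℕ) (h : (Fin (d + 1) → Fin b) → Y.V → Fin (d + 1)),
      ¬ (grid Y h ℓ).graph.Colorable (m + 1) := by
  classical
  have := Fintype.ofFinite Y.V
  have : Nonempty Y.V := not_isEmpty_iff.1 fun _ => hY (SimpleGraph.Colorable.of_isEmpty _)
  obtain ⟨d, b, h, hh⟩ := exists_directions Y.V (Nat.succ_pos m) ℓ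
  refine ⟨d, b, h, fun ⟨C⟩ => hY ?_⟩
  obtain ⟨J, hJ, c, hc⟩ := hh fun e => C (line e)
  let C' : Y.graph.Coloring {a : Fin (m + 1) // a ≠ c} := SimpleGraph.Coloring.mk
    (fun y => ⟨C (leaf J y), fun hy => C.valid (v := leaf J y)
      (w := line (lineThrough J (h J y))) ⟨hJ, rfl⟩ (hy.trans (hc y).symm)⟩)
    (fun {y z} hyz heq => C.valid (v := leaf J y) (w := leaf J z) ⟨rfl, hyz⟩
      (congrArg Subtype.val heq))
  have := C'.colorable
  rwa [Fintype.card_subtype_compl, Fintype.card_subtype_eq, Fintype.card_fin] at this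

theorem exists_hasSeparatedBranches (ℓ k : ℕ) :
    ∃ G : OrderedGraph.{u}, G.HasSeparatedBranches ℓ ∧ ¬ G.graph.Colorable k := by
  induction k with
  | zero =>
    refine ⟨⟨PUnit, ⊥⟩, ⟨fun l h3 _ hnd => ?_, fun u l₁ l₂ _ _ _ hu => Or.inl fun x hx => ?_⟩, ?_⟩
    · have := List.Nodup.length_le_card hnd
      simp at this
      omega
    · exact absurd (hu x (List.mem_append_left _ hx)) (by simp)
    · rw [SimpleGraph.colorable_zero_iff]
      exact fun hE => hE.false PUnit.unit
  | succ m ih =>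
    obtain ⟨Y, hY, hc⟩ := ih
    obtain ⟨d, b, h, hh⟩ := exists_grid_not_colorable Y hc ℓ
    exact ⟨grid Y h ℓ, hasSeparatedBranches_grid hY, hh⟩

/-! ### Cycles and tangled paths -/

theorem HasSeparatedBranches.lt_length {G : OrderedGraph.{u}} {ℓ : ℕ}
    (hG : G.HasSeparatedBranches ℓ) {v : G.V} {c : G.graph.Walk v v} (hc : c.IsCycle) :
    ℓ < c.length := by
  by_contra! hℓ
  have h3 := hc.three_le_length
  have hnd := hc.support_nodup
  cases c with
  | nil => simp at h3
  | cons hadj p =>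
    rw [SimpleGraph.Walk.support_cons, List.tail_cons] at hnd
    have hsupp : p.support.dropLast ++ [v] = p.support := by
      have := List.dropLast_append_getLast p.support_ne_nil
      rwa [p.getLast_support] at this
    have hlen : (v :: p.support.dropLast).length = p.length + 1 := by simp
    rw [SimpleGraph.Walk.length_cons] at h3 hℓ
    refine hG.1 (v :: p.support.dropLast) (by omega) (by omega) ?_ ?_
    · rw [← hsupp] at hnd
      exact (List.perm_append_comm (l₁ := [v])).nodup_iff.2 hnd
    · rw [Cycle.chain_coe_cons, hsupp]
      exact (SimpleGraph.Walk.cons hadj p).isChain_adj_support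

theorem HasSeparatedBranches.not_contains {G H : OrderedGraph.{u}} {v : H.V}
    {c : H.graph.Walk v v} (hG : G.HasSeparatedBranches c.length) (hc : c.IsCycle) :
    ¬ G.Contains H := by
  rintro ⟨φ, hφ⟩
  have := hG.lt_length (hc.map (f := φ) hφ.injective)
  simp at this

theorem EdgesCross.map {α β : Type u} [LinearOrder α] [LinearOrder β] {φ : α → β}
    (hφ : StrictMono φ) {x y z w : α} (h : EdgesCross s(x, y) s(z, w)) :
    EdgesCross s(φ x, φ y) s(φ z, φ w) := by
  obtain ⟨a, b, c, d, h1, h2, h3, h4⟩ := h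
  refine ⟨φ a, φ b, φ c, φ d, hφ h1, hφ h2, hφ h3, ?_⟩
  refine h4.imp ?_ ?_ <;> rintro ⟨h5, h6⟩
  · exact ⟨congrArg (Sym2.map φ) h5, congrArg (Sym2.map φ) h6⟩
  · exact ⟨congrArg (Sym2.map φ) h5, congrArg (Sym2.map φ) h6⟩

theorem EdgesCross.map_strictAnti {α β : Type u} [LinearOrder α] [LinearOrder β] {φ : α → β}
    (hφ : StrictAnti φ) {x y z w : α} (h : EdgesCross s(x, y) s(z, w)) :
    EdgesCross s(φ x, φ y) s(φ z, φ w) := by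
  obtain ⟨a, b, c, d, h1, h2, h3, h4⟩ := h
  refine ⟨φ d, φ c, φ b, φ a, hφ h3, hφ h2, hφ h1, ?_⟩
  refine h4.symm.imp ?_ ?_ <;> rintro ⟨h5, h6⟩
  · exact ⟨(congrArg (Sym2.map φ) h6).trans Sym2.eq_swap,
      (congrArg (Sym2.map φ) h5).trans Sym2.eq_swap⟩
  · exact ⟨(congrArg (Sym2.map φ) h6).trans Sym2.eq_swap,
      (congrArg (Sym2.map φ) h5).trans Sym2.eq_swap⟩

/-- Edges of two branches that leave the leftmost vertex `u` do not cross if one of the branches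
precedes the other. -/
theorem not_edgesCross_of_separated {α : Type u} [LinearOrder α] {u : α} {S T : Set α}
    (hS : ∀ x ∈ S, u < x) (hT : ∀ x ∈ T, u < x)
    (hST : (∀ x ∈ S, ∀ y ∈ T, x < y) ∨ ∀ x ∈ S, ∀ y ∈ T, y < x) {e e' : Sym2 α}
    (he : ∀ x ∈ e, x = u ∨ x ∈ S) (he' : ∀ x ∈ e', x = u ∨ x ∈ T) : ¬ EdgesCross e e' := by
  have key : ∀ {S T : Set α}, (∀ x ∈ S, u < x) → (∀ x ∈ T, u < x) →
      ((∀ x ∈ S, ∀ y ∈ T, x < y) ∨ ∀ x ∈ S, ∀ y ∈ T, y < x) → ∀ {a b c d : α},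
      (∀ x ∈ s(a, b), x = u ∨ x ∈ S) → (∀ x ∈ s(c, d), x = u ∨ x ∈ T) →
      a < c → c < b → b < d → False := by
    intro S T hS hT hST a b c d hab hcd h1 h2 h3
    have ha : u ≤ a := by
      rcases hab a (Sym2.mem_mk_left _ _) with rfl | ha
      · exact le_rfl
      · exact (hS a ha).le
    have hc : c ∈ T := (hcd c (Sym2.mem_mk_left _ _)).resolve_left (ha.trans_lt h1).ne'
    have hb : b ∈ S := (hab b (Sym2.mem_mk_right _ _)).resolve_left
      (ha.trans_lt (h1.trans h2)).ne'
    have hd : d ∈ T := (hcd d (Sym2.mem_mk_right _ _)).resolve_left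
      (ha.trans_lt (h1.trans (h2.trans h3))).ne'
    rcases hST with hST | hST
    · exact lt_asymm h2 (hST b hb c hc)
    · exact lt_asymm h3 (hST b hb d hd)
  rintro ⟨a, b, c, d, h1, h2, h3, ⟨rfl, rfl⟩ | ⟨rfl, rfl⟩⟩
  · exact key hS hT hST he he' h1 h2 h3
  · exact key hT hS (hST.symm.imp (fun h x hx y hy => h y hy x hx)
      fun h x hx y hy => h y hy x hx) he' he h1 h2 h3

theorem HasSeparatedBranches.not_edgesCross {G : OrderedGraph.{u}} {n : ℕ}
    (hG : G.HasSeparatedBranches n) {q : Fin n → G.V} (hq : q.Injective)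
    (hadj : ∀ j j' : Fin n, (j : ℕ) + 1 = j' → G.graph.Adj (q j) (q j')) {i : Fin n}
    (hi : ∀ j, q i ≤ q j) {j j' k k' : Fin n} (hj : (j : ℕ) + 1 = j') (hj' : j' ≤ i) (hk : i ≤ k)
    (hk' : (k : ℕ) + 1 = k') : ¬ EdgesCross s(q j, q j') s(q k, q k') := by
  have hi' : (i : ℕ) < (List.ofFn q).length := by simp
  have hL : ((List.ofFn q).take i).reverse.reverse ++ q i :: (List.ofFn q).drop (i + 1) =
      List.ofFn q := by
    rw [List.reverse_reverse]
    conv_rhs => rw [← List.take_append_drop i (List.ofFn q), List.drop_eq_getElem_cons hi']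
    simp
  have hmem1 : ∀ {x}, x ∈ ((List.ofFn q).take i).reverse ↔ ∃ j, j < i ∧ q j = x := by
    intro x
    rw [List.mem_reverse, List.mem_take_iff_getElem]
    constructor
    · rintro ⟨m, hm, rfl⟩
      simp only [List.length_ofFn, lt_min_iff] at hm
      exact ⟨⟨m, hm.2⟩, hm.1, by simp⟩
    · rintro ⟨m, hm, rfl⟩
      exact ⟨m, by simpa using hm, by simp⟩
  have hmem2 : ∀ {x}, x ∈ (List.ofFn q).drop (i + 1) ↔ ∃ j, i < j ∧ q j = x := by
    intro x
    rw [List.mem_drop_iff_getElem]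
    constructor
    · rintro ⟨m, hm, rfl⟩
      simp only [List.length_ofFn] at hm
      exact ⟨⟨(i : ℕ) + 1 + m, by omega⟩, Fin.lt_def.2 (by simp; omega), by simp⟩
    · rintro ⟨m, hm, rfl⟩
      have hm' := Fin.lt_def.1 hm
      refine ⟨m - (i + 1), by simp; omega, ?_⟩
      simp only [List.getElem_ofFn]
      congr 1
      exact Fin.ext (by simp; omega)
  have hlt : ∀ j, j ≠ i → q i < q j := fun j hj => lt_of_le_of_ne (hi j) fun h => hj (hq h.symm)
  have hS : ∀ x ∈ ((List.ofFn q).take i).reverse, q i < x := fun x hx => by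
    obtain ⟨m, hm, rfl⟩ := hmem1.1 hx
    exact hlt m hm.ne
  have hT : ∀ x ∈ (List.ofFn q).drop (i + 1), q i < x := fun x hx => by
    obtain ⟨m, hm, rfl⟩ := hmem2.1 hx
    exact hlt m hm.ne'
  have hST := hG.2 (q i) ((List.ofFn q).take i).reverse ((List.ofFn q).drop (i + 1))
    (by rw [hL, List.isChain_ofFn]; exact fun m hm => hadj _ _ rfl)
    (by rw [hL]; exact List.nodup_ofFn.2 hq) (by rw [hL]; simp)
    (fun x hx => (List.mem_append.1 hx).elim (hS x) (hT x))
  refine not_edgesCross_of_separated (S := {x | x ∈ ((List.ofFn q).take i).reverse})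
    (T := {x | x ∈ (List.ofFn q).drop (i + 1)}) hS hT hST ?_ ?_
  · have key : ∀ m ≤ i, q m = q i ∨ q m ∈ ((List.ofFn q).take i).reverse := fun m hm =>
      hm.eq_or_lt.imp (congrArg q) fun hm => hmem1.2 ⟨m, hm, rfl⟩
    intro x hx
    rcases Sym2.mem_iff.1 hx with rfl | rfl
    · exact key j (Fin.le_def.2 (by have := Fin.le_def.1 hj'; omega))
    · exact key j' hj'
  · have key : ∀ m, i ≤ m → q m = q i ∨ q m ∈ (List.ofFn q).drop (i + 1) := fun m hm =>
      hm.eq_or_lt.imp (fun h => congrArg q h.symm) fun hm => hmem2.2 ⟨m, hm, rfl⟩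
    intro x hx
    rcases Sym2.mem_iff.1 hx with rfl | rfl
    · exact key k hk
    · exact key k' (Fin.le_def.2 (by have := Fin.le_def.1 hk; omega))

/-- The ordered graph with the opposite vertex order. -/
def dual (G : OrderedGraph.{u}) : OrderedGraph.{u} where
  V := G.Vᵒᵈ
  graph := G.graph

theorem Contains.trans {G H K : OrderedGraph.{u}} (hGH : G.Contains H) (hHK : H.Contains K) :
    G.Contains K := by
  obtain ⟨φ, hφ⟩ := hGH
  obtain ⟨ψ, hψ⟩ := hHK
  exact ⟨φ.comp ψ, hφ.comp hψ⟩

/-- A tangled path has a leftmost or a rightmost inner vertex; accordingly, it is contained in no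
graph with separated branches, or in no order dual of one. -/
theorem IsTangledPath.exists_not_contains {P : OrderedGraph.{u}} (hP : P.IsTangledPath) :
    ∃ n : ℕ, (∀ G : OrderedGraph.{u}, G.HasSeparatedBranches n → ¬ G.Contains P) ∨
      ∀ G : OrderedGraph.{u}, G.HasSeparatedBranches n → ¬ G.dual.Contains P := by
  obtain ⟨n, p, i, -, -, hi, j, j', k, k', hj, hj', hk, hk', hcross⟩ := hP
  have hp : ∀ j j' : Fin n, (j : ℕ) + 1 = j' → P.graph.Adj (p j) (p j') := fun j j' hjj =>
    p.map_adj_iff.2 (SimpleGraph.pathGraph_adj.2 (Or.inl hjj))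
  refine ⟨n, hi.imp (fun hi G hG => ?_) fun hi G hG => ?_⟩
  · rintro ⟨φ, hφ⟩
    exact hG.not_edgesCross (q := fun m => φ (p m)) (hφ.injective.comp p.injective)
      (fun j j' hjj => φ.map_adj (hp j j' hjj)) (fun m => hφ.monotone (hi _)) hj hj' hk hk'
      (hcross.map hφ)
  · rintro ⟨φ, hφ⟩
    let φ' : P.V → G.V := fun x => OrderDual.ofDual (φ x)
    have hφ' : StrictAnti φ' := fun _ _ hxy => hφ hxy
    exact hG.not_edgesCross (q := fun m => φ' (p m)) (hφ'.injective.comp p.injective)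
      (fun j j' hjj => φ.map_adj (hp j j' hjj)) (fun m => hφ'.antitone (hi _)) hj hj' hk hk'
      (hcross.map_strictAnti hφ')

/-! ### Shift graphs and bonnets -/

/-- The shift graph on the pairs of elements of `Fin N`, ordered lexicographically: `(i, j)` and
`(j, k)` are adjacent if `i < j < k`. The pairs `(i, j)` with `j ≤ i` are isolated vertices. -/
def shiftGraph (N : ℕ) : OrderedGraph.{u} where
  V := ULift.{u} (Fin N ×ₗ Fin N)
  graph :=
    { Adj := fun x y =>
        (ofLex x.down).1 < (ofLex x.down).2 ∧ (ofLex y.down).1 < (ofLex y.down).2 ∧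
          ((ofLex x.down).2 = (ofLex y.down).1 ∨ (ofLex y.down).2 = (ofLex x.down).1)
      symm := ⟨fun _ _ h => ⟨h.2.1, h.1, h.2.2.symm⟩⟩
      loopless := ⟨fun _ h => by
        rcases h.2.2 with h' | h'
        · exact h.1.ne' h'
        · exact h.1.ne' h'⟩ }

/-- In a colouring `c` of the shift graph the sets `{c (i, j) | i < j}`, `i : Fin N`, are distinct,
since for `i < j` the colour `c (i, j)` does not belong to the `j`-th set. -/
theorem le_of_colorable_shiftGraph {N k : ℕ}
    (h : (shiftGraph.{u} N).graph.Colorable k) : N ≤ 2 ^ k := by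
  classical
  obtain ⟨C⟩ := h
  let A : Fin N → Finset (Fin k) := fun i =>
    (Finset.univ.filter fun j => i < j).image fun j => C (ULift.up (toLex (i, j)))
  have hA : ∀ i j : Fin N, i < j → A i ≠ A j := by
    intro i j hij heq
    have h1 : C (ULift.up (toLex (i, j))) ∈ A i :=
      Finset.mem_image_of_mem _ (by simpa using hij)
    rw [heq] at h1
    obtain ⟨l, hl, hC⟩ := Finset.mem_image.1 h1
    have hjl : j < l := by simpa using hl
    exact C.valid (v := ULift.up (toLex (j, l))) (w := ULift.up (toLex (i, j)))
      ⟨hjl, hij, Or.inr rfl⟩ hC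
  have hinj : A.Injective := fun i j hij => by
    rcases lt_trichotomy i j with h | h | h
    · exact absurd hij (hA i j h)
    · exact h
    · exact absurd hij.symm (hA j i h)
  simpa using Fintype.card_le_of_injective A hinj

/-- All right neighbours of `(i, j)` in the shift graph have the form `(j, _)`, and so have all
vertices between two of them; these are pairwise nonadjacent. -/
theorem not_adj_shiftGraph {N : ℕ} {u₁ u₂ u₃ u₄ u₅ : (shiftGraph.{u} N).V} (h12 : u₁ < u₂)
    (h23 : u₂ ≤ u₃) (h34 : u₃ < u₄) (h45 : u₄ ≤ u₅) (e12 : (shiftGraph.{u} N).graph.Adj u₁ u₂)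
    (e15 : (shiftGraph.{u} N).graph.Adj u₁ u₅) : ¬ (shiftGraph.{u} N).graph.Adj u₃ u₄ := by
  have hmono : ∀ {x y : (shiftGraph.{u} N).V}, x ≤ y → (ofLex x.down).1 ≤ (ofLex y.down).1 :=
    fun hxy => Prod.Lex.monotone_fst _ _ hxy
  have key : ∀ {x y : (shiftGraph.{u} N).V}, x < y → (shiftGraph.{u} N).graph.Adj x y →
      (ofLex x.down).2 = (ofLex y.down).1 := fun hxy hadj =>
    hadj.2.2.resolve_right fun h => (hadj.2.1.trans_eq h).not_ge (hmono hxy.le)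
  have h2 := key h12 e12
  have h5 := key (h12.trans_le (h23.trans (h34.le.trans h45))) e15
  have h34' : (ofLex u₄.down).1 ≤ (ofLex u₃.down).1 :=
    ((hmono h45).trans_eq (h5.symm.trans h2)).trans (hmono h23)
  intro e34
  have h3 := key h34 e34
  exact (e34.1.trans_eq h3).not_ge h34'

/-- A bonnet is contained in no shift graph, or in no order dual of a shift graph. -/
theorem IsBonnet.not_contains {B : OrderedGraph.{u}} (hB : B.IsBonnet) :
    (∀ N, ¬ (shiftGraph.{u} N).Contains B) ∨ ∀ N, ¬ (shiftGraph.{u} N).dual.Contains B := by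
  obtain ⟨-, u₁, u₂, u₃, u₄, u₅, -, h⟩ := hB
  refine h.imp ?_ ?_ <;> rintro ⟨h1, h2, h3, h4, hE⟩ N ⟨φ, hφ⟩
  · have hadj : ∀ {x y}, s(x, y) ∈ B.graph.edgeSet → (shiftGraph.{u} N).graph.Adj (φ x) (φ y) :=
      fun h => φ.map_adj h
    exact not_adj_shiftGraph (hφ h1) (hφ.monotone h2) (hφ h3) (hφ.monotone h4)
      (hadj (by simp [hE])) (hadj (by simp [hE])) (hadj (by simp [hE]))
  · have hadj : ∀ {x y}, s(x, y) ∈ B.graph.edgeSet → (shiftGraph.{u} N).graph.Adj (φ y) (φ x) :=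
      fun h => (φ.map_adj h).symm
    exact not_adj_shiftGraph (u₁ := φ u₅) (u₂ := φ u₄) (u₃ := φ u₃) (u₄ := φ u₂) (u₅ := φ u₁)
      (hφ h4) (hφ.monotone h3) (hφ h2) (hφ.monotone h1)
      (hadj (by simp [hE])) (hadj (by simp [hE])) (hadj (by simp [hE]))

theorem exists_mem_forb_not_colorable {H : OrderedGraph.{u}}
    (hH : H.ContainsCycle ∨ H.ContainsBonnet ∨ H.ContainsTangledPath) (k : ℕ) :
    ∃ G ∈ Forb H, ¬ G.graph.Colorable k := by
  rcases hH with ⟨v, c, hc⟩ | ⟨B, hB, hHB⟩ | ⟨P, hP, hHP⟩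
  · obtain ⟨G, hG, hk⟩ := exists_hasSeparatedBranches.{u} c.length k
    exact ⟨G, hG.not_contains hc, hk⟩
  · have hk : ¬ (shiftGraph.{u} (2 ^ k + 1)).graph.Colorable k := fun h => by
      have := le_of_colorable_shiftGraph h
      omega
    rcases hB.not_contains with h | h
    · exact ⟨shiftGraph _, fun hG => h _ (hG.trans hHB), hk⟩
    · exact ⟨(shiftGraph _).dual, fun hG => h _ (hG.trans hHB), hk⟩
  · obtain ⟨n, hn⟩ := hP.exists_not_contains
    obtain ⟨G, hG, hk⟩ := exists_hasSeparatedBranches.{u} n k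
    rcases hn with h | h
    · exact ⟨G, fun hGH => h G hG (hGH.trans hHP), hk⟩
    · exact ⟨G.dual, fun hGH => h G hG (hGH.trans hHP), hk⟩

end OrderedGraph

theorem theorem1 (H : OrderedGraph.{u})
    (hH : H.ContainsCycle ∨ H.ContainsBonnet ∨ H.ContainsTangledPath) :
    OrderedGraph.f H = ⊤ ∧
      ∀ k : ℕ, ∃ G ∈ OrderedGraph.Forb H, (k : ℕ∞) ≤ G.graph.chromaticNumber := by
  have key : ∀ k : ℕ, ∃ G ∈ OrderedGraph.Forb H, (k : ℕ∞) ≤ G.graph.chromaticNumber := by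
    intro k
    obtain ⟨G, hG, hk⟩ := OrderedGraph.exists_mem_forb_not_colorable hH k
    rw [← SimpleGraph.chromaticNumber_le_iff_colorable, not_le] at hk
    exact ⟨G, hG, hk.le⟩
  refine ⟨ENat.eq_top_iff_forall_ge.2 fun k => ?_, key⟩
  obtain ⟨G, hG, hk⟩ := key k
  exact hk.trans (le_iSup₂ (f := fun (G : OrderedGraph.{u}) (_ : G ∈ OrderedGraph.Forb H) =>
    G.graph.chromaticNumber) G hG)
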